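/- Let $\Gamma$ be a locally compact (Hausdorff) group with left Haar measure $|\cdot|$, let $X$ be a probability space, and let $G$ be a group of unitary operators on $L^2(X)$ (real or complex scalars) that act as isometric algebra homomorphisms on $L^\infty(X)$. A map $g\colon\Gamma\to G$ is called measurable if, for every $f\in L^2(X)$, the maps $n\mapsto g(n)f$ and $n\mapsto g(n)^{-1}f$ are strongly measurable (almost everywhere) on every compact subset of $\Gamma$. A system is a tuple $\mathbf g=(g_0,\dots,g_j)$, $j\ge 0$, of measurable maps $\Gamma\to G$ with $g_0\equiv 1_G$. For $a,b\in\Gamma$ and $g,h\colon\Gamma\to G$ put $\langle g|h\rangle_{a,b}(n)=g(n)\,g(anb)^{-1}h(anb)$; for $j\ge 1$ the $(a,b)$-reduction of $\mathbf g$ is $$\mathbf g^*_{a,b}=\bigl(g_0,\dots,g_{j-1},\langle g_j|g_0\rangle_{a,b},\dots,\langle g_j|g_{j-1}\rangle_{a,b}\bigr).$$ The relation "$\mathbf g$ has complexity at most $c$" ($c\in\mathbb N$) is the smallest relation such that (i) the trivial system $(1_G)$ has complexity at most $0$; (ii) if $\mathbf g^*_{a,b}$ has complexity at most $c$ for all $a,b\in\Gamma$,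 then the system $\mathbf g$ has complexity at most $c+1$; (iii) if $\mathbf g$ has complexity at most $c$ and every member of the system $\tilde{\mathbf g}$ is of the form $n\mapsto g(n)k$ with $g\in\mathbf g$, $k\in G$, then $\tilde{\mathbf g}$ has complexity at most $c$. A system has finite complexity if it has complexity at most $c$ for some $c\in\mathbb N$. A Følner net in $\Gamma$ is a net $(F_\alpha)_{\alpha\in A}$, indexed by a nonempty directed set $A$, of nonempty compact subsets of $\Gamma$ of positive measure such that $\sup_{l\in K}|lF_\alpha\mathbin{\Delta}F_\alpha|/|F_\alpha|\to 0$ for every compact $K\subset\Gamma$ (Følner sequences are the case $A=\mathbb N$). Let $\mathbf g=(g_0,\dots,g_j)$ be a system of finite complexity and let $f_0,\dots,f_j\in L^\infty(X)$. Then the $L^2(X)$-valued function $n\mapsto g_0(n)f_0\cdots g_j(n)f_j$ is integrable on every compact subset of $\Gamma$, and there is $L\in L^2(X)$ such that for every Følner net $(F_\alpha)_{\alpha\in A}$ in $\Gamma$ the averages over the Følner sets $I=aF_\alpha b$, $a,b\in\Gamma$, $$\frac1{|aF_\alpha b|}\int_{n\in aF_\alpha b} g_0(n)f_0\cdot g_1(n)f_1\cdots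 g_j(n)f_j\,dn,$$ converge to $L$ in $L^2(X)$ as $\lfloor I\rfloor=\alpha\to\infty$ along $A$, that is, uniformly in $a,b\in\Gamma$. In particular the limit does not depend on the Følner net. -/

import Mathlib

open MeasureTheory Filter Topology
open scoped ENNReal

noncomputable section

namespace NilErgodic

section Space

variable (𝕜 : Type*) [RCLike 𝕜] {X : Type*} [MeasurableSpace X] (μ : Measure X)

/-- The essentially bounded functions `L^∞(X)`, modulo equality almost everywhere, as a
multiplicative submonoid of the measurable functions modulo equality almost everywhere. -/
def Linfty : Submonoid (X →ₘ[μ] 𝕜) where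
  carrier := {f | MemLp (f : X → 𝕜) ∞ μ}
  mul_mem' {f g} hf hg := by
    have h : MemLp ((f : X → 𝕜) * (g : X → 𝕜)) ∞ μ := MemLp.mul hg hf
    exact (memLp_congr_ae (AEEqFun.coeFn_mul f g)).2 h
  one_mem' :=
    (memLp_congr_ae (AEEqFun.coeFn_one (α := X) (μ := μ) (β := 𝕜))).2 (memLp_top_const (1 : 𝕜))

/-- Unitary (for `𝕜 = ℝ`: orthogonal) operators on `L²(X)`. They form a group under composition. -/
abbrev UnitaryOp := Lp 𝕜 2 μ ≃ₗᵢ[𝕜] Lp 𝕜 2 μ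

variable {𝕜 μ}

/-- The inclusion `L^∞(X) ⊆ L²(X)` for a probability space `X`. -/
def toL2 [IsProbabilityMeasure μ] (f : Linfty 𝕜 μ) : Lp 𝕜 2 μ :=
  ⟨f.1, Lp.mem_Lp_iff_memLp.2 (MemLp.mono_exponent f.2 le_top)⟩

/-- A unitary operator on `L²(X)` acts as an isometric algebra homomorphism on `L^∞(X)`: it
preserves essential suprema of bounded functions (in particular it maps bounded functions to
bounded functions) and products of bounded functions. Linearity is part of `UnitaryOp`. -/
structure ActsOnLinfty [IsProbabilityMeasure μ] (U : UnitaryOp 𝕜 μ) : Prop where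
  norm_map : ∀ f : Linfty 𝕜 μ,
    eLpNorm (U (toL2 f) : X → 𝕜) ∞ μ = eLpNorm (f.1 : X → 𝕜) ∞ μ
  map_mul : ∀ f g : Linfty 𝕜 μ,
    (U (toL2 (f * g)) : X →ₘ[μ] 𝕜) = (U (toL2 f) : X →ₘ[μ] 𝕜) * (U (toL2 g) : X →ₘ[μ] 𝕜)

/-- The restriction of such an operator to `L^∞(X)`. -/
def actLinfty [IsProbabilityMeasure μ] (U : UnitaryOp 𝕜 μ) (hU : ActsOnLinfty U)
    (f : Linfty 𝕜 μ) : Linfty 𝕜 μ :=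
  ⟨(U (toL2 f)).1, Lp.aestronglyMeasurable _, by
    have h : eLpNorm (U (toL2 f) : X → 𝕜) ∞ μ < ∞ := by
      rw [hU.norm_map f]
      exact f.2.2
    exact h⟩

end Space

section Systems

variable {𝕜 : Type*} [RCLike 𝕜] {X : Type*} [MeasurableSpace X] {μ : Measure X}
  {Γ : Type*} [Group Γ] [TopologicalSpace Γ] [MeasurableSpace Γ]

/-- Measurability of a map from `Γ` to a group `G` of unitary operators on `L²(X)`, with respect to
the strong operator topology: on every compact set, `n ↦ g(n) f` and `n ↦ g(n)⁻¹ f` are strongly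
measurable (almost everywhere) for every `f ∈ L²(X)`. -/
def MeasurableMap (ν : Measure Γ) (G : Subgroup (UnitaryOp 𝕜 μ)) (g : Γ → G) : Prop :=
  ∀ K : Set Γ, IsCompact K → ∀ f : Lp 𝕜 2 μ,
    AEStronglyMeasurable (fun n => (g n : UnitaryOp 𝕜 μ) f) (ν.restrict K) ∧
    AEStronglyMeasurable (fun n => ((g n)⁻¹ : G).1 f) (ν.restrict K)

/-- A system: a tuple `(g₀, …, g_j)` of measurable maps `Γ → G` with `g₀ ≡ 1`. -/
structure IsSystem (ν : Measure Γ) (G : Subgroup (UnitaryOp 𝕜 μ)) (g : List (Γ → G)) : Prop where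
  head_eq : g.head? = some (fun _ => 1)
  measurable : ∀ φ ∈ g, MeasurableMap ν G φ

/-- The `(a,b)`-reduction `⟨g|h⟩_{a,b}(n) = g(n) g(anb)⁻¹ h(anb)` of two maps. -/
def bracket {Γ G : Type*} [Group Γ] [Group G] (a b : Γ) (g h : Γ → G) : Γ → G :=
  fun n => g n * (g (a * n * b))⁻¹ * h (a * n * b)

/-- The `(a,b)`-reduction of the tuple `(g₀, …, g_{j-1}, g_j)`, where `g' = (g₀, …, g_{j-1})` and
`h = g_j`: the tuple `(g₀, …, g_{j-1}, ⟨g_j|g₀⟩_{a,b}, …, ⟨g_j|g_{j-1}⟩_{a,b})`. -/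
def reduction {Γ G : Type*} [Group Γ] [Group G] (a b : Γ) (g' : List (Γ → G)) (h : Γ → G) :
    List (Γ → G) :=
  g' ++ g'.map (bracket a b h)

/-- `ComplexityLE ν G c g`: the system `g` has complexity at most `c`. -/
inductive ComplexityLE (ν : Measure Γ) (G : Subgroup (UnitaryOp 𝕜 μ)) :
    ℕ → List (Γ → G) → Prop
  /-- The trivial system has complexity at most zero. -/
  | trivial : ComplexityLE ν G 0 [fun _ => 1]
  /-- If all reductions of a system have complexity at most `c`, then the system has complexity
  at most `c + 1`. -/
  | reduce {c : ℕ} (g' : List (Γ → G)) (h : Γ → G) (hsys : IsSystem ν G (g' ++ [h]))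
      (hred : ∀ a b : Γ, ComplexityLE ν G c (reduction a b g' h)) :
      ComplexityLE ν G (c + 1) (g' ++ [h])
  /-- Cheating: every system consisting of maps `ψ k` with `ψ` in a system of complexity at most
  `c` and `k ∈ G` has complexity at most `c`. -/
  | cheat {c : ℕ} (g gt : List (Γ → G)) (hg : ComplexityLE ν G c g) (hsys : IsSystem ν G gt)
      (hcheat : ∀ φ ∈ gt, ∃ ψ ∈ g, ∃ k : G, φ = fun n => ψ n * k) :
      ComplexityLE ν G c gt

/-- The system `g` has finite complexity. -/
def FiniteComplexity (ν : Measure Γ) (G : Subgroup (UnitaryOp 𝕜 μ)) (g : List (Γ → G)) : Prop :=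
  ∃ c : ℕ, ComplexityLE ν G c g

/-- The function `n ↦ g₀(n) f₀ ⋯ g_j(n) f_j`, as a function with values in `L²(X)`. The product is
taken in `L^∞(X)`. -/
def productMap [IsProbabilityMeasure μ] {G : Subgroup (UnitaryOp 𝕜 μ)}
    (hG : ∀ U ∈ G, ActsOnLinfty U) (g : List (Γ → G)) (f : Fin g.length → Linfty 𝕜 μ) (n : Γ) :
    Lp 𝕜 2 μ :=
  toL2 (∏ i : Fin g.length, actLinfty (g.get i n).1 (hG _ (g.get i n).2) (f i))

/-- The multiple ergodic average `|I|⁻¹ ∫_{n ∈ I} g₀(n) f₀ ⋯ g_j(n) f_j`, a Bochner integral in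
`L²(X)` with respect to the Haar measure `ν`. -/
def ergodicAverage [IsProbabilityMeasure μ] (ν : Measure Γ) {G : Subgroup (UnitaryOp 𝕜 μ)}
    (hG : ∀ U ∈ G, ActsOnLinfty U) (g : List (Γ → G)) (f : Fin g.length → Linfty 𝕜 μ)
    (I : Set Γ) : Lp 𝕜 2 μ :=
  (((ν I).toReal)⁻¹ : ℝ) • ∫ n in I, productMap hG g f n ∂ν

end Systems

section Folner

variable {Γ : Type*} [Group Γ] [TopologicalSpace Γ] [MeasurableSpace Γ]

/-- The two-sided translate `a F b`. -/
def twoSidedTranslate {Γ : Type*} [Group Γ] (a : Γ) (F : Set Γ) (b : Γ) : Set Γ :=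
  (fun n => a * n * b) '' F

/-- A (left) Følner net, with respect to the Haar measure `ν`: a net of nonempty compact sets of
positive measure such that `sup_{l ∈ K} |l F_α Δ F_α| / |F_α| → 0` for every compact set `K`.
Følner sequences are the case `A = ℕ`. -/
structure IsFolnerNet (ν : Measure Γ) {A : Type*} [Preorder A] (F : A → Set Γ) : Prop where
  nonempty : ∀ α, (F α).Nonempty
  isCompact : ∀ α, IsCompact (F α)
  measure_pos : ∀ α, 0 < ν (F α)
  tendsto : ∀ K : Set Γ, IsCompact K →
    Tendsto (fun α => ⨆ l ∈ K, ν (symmDiff ((fun n => l * n) '' F α) (F α)) / ν (F α))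
      atTop (𝓝 0)

end Folner

end NilErgodic

end

open MeasureTheory Filter Topology
open scoped ENNReal

set_option linter.unusedSectionVars false

noncomputable section
-- The strategy, in the spirit of Walsh, is to prove a quantitative statement that is strong enough
-- for induction on the complexity. A finite sequence of pairs of sets is rapid if each later set is
-- almost invariant under all earlier ones, up to conjugation by a group element of its own. For
-- each complexity `c` and each `ε` there are `N` and `δ`, uniform over all systems of complexity at
-- most `c` and all functions in the unit ball of `L^∞`, such that along a `δ`-rapid sequence at
-- most `N` pairs have averages that differ by `ε` or more (`exists_fluctuationBound`). If the
-- averages over translates of Følner sets were not Cauchy, bad pairs could be collected into a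
-- rapid sequence of length `N + 1` (`isCauchyAverage_of_fluctuationBound`).
--
-- For the induction step, write the product as `P(n) · h(n) f`, let `A i φ` be the difference of
-- the averages of `P(n) · h(n) φ` over `I i` and `I' i`, and put `e i = A i f / 2`. Moving `P(n)`
-- and `h(n)` across the inner product gives a vector `τ i` with `⟨τ i, φ⟩ = ⟨e i, A i φ⟩` in real
-- parts, so `τ i` correlates with `f` by at least `ε² / 2`. On the other hand, `τ k` is a
-- difference of two averages `φ` of the dual integrand `h(n)⁻¹ (e k · conj P(n))`. By almost
-- invariance, such a `φ` is close, in `L¹` over the earlier sets in the variable `l`, to a convex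
-- combination of the dual integrand at the points `a l a⁻¹ z` (`exists_convexCombination`).
-- Applying `h(l)` and multiplying by `P(l)` turns each term into a product along the `(a, a⁻¹
-- z)`-reduction (`listProd_reducedList`). The induction hypothesis then makes `A i φ` small for
-- most `i < k`. Hence the `τ i` are almost orthogonal, and only boundedly many of them can
-- correlate with `f` (`card_le_of_almost_orthogonal`).
namespace NilErgodic

/-! ### The unit ball of `L^∞` inside `L²`. -/

section BoundedFunctions

variable {𝕜 : Type*} [RCLike 𝕜] {X : Type*} [MeasurableSpace X] {μ : Measure X}

lemma eLpNorm_top_le_one_iff {E : Type*} [NormedAddCommGroup E] {f : X → E} :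
    eLpNorm f ∞ μ ≤ 1 ↔ ∀ᵐ x ∂μ, ‖f x‖ ≤ 1 := by
  rw [eLpNorm_exponent_top]
  constructor
  · intro h
    filter_upwards [ae_le_eLpNormEssSup (f := f) (μ := μ)] with x hx
    have := hx.trans h
    rwa [← ofReal_norm, ENNReal.ofReal_le_one] at this
  · intro h
    simpa using eLpNormEssSup_le_of_ae_bound h

variable (𝕜 μ) in
/-- The closed unit ball of `L^∞(X)`. -/
def unitBall : Submonoid (Linfty 𝕜 μ) where
  carrier := {f | eLpNorm (f.1 : X → 𝕜) ∞ μ ≤ 1}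
  mul_mem' {f g} hf hg := by
    simp only [Set.mem_ofPred_eq, eLpNorm_top_le_one_iff] at *
    filter_upwards [hf, hg, AEEqFun.coeFn_mul f.1 g.1] with x h1 h2 h3
    rw [Submonoid.coe_mul, h3, Pi.mul_apply, norm_mul]
    exact mul_le_one₀ h1 (norm_nonneg _) h2
  one_mem' := by
    simp only [Set.mem_ofPred_eq, eLpNorm_top_le_one_iff]
    filter_upwards [AEEqFun.coeFn_one (α := X) (μ := μ) (β := 𝕜)] with x hx
    rw [Submonoid.coe_one, hx]
    simp

lemma mem_unitBall_iff {f : Linfty 𝕜 μ} : f ∈ unitBall 𝕜 μ ↔ ∀ᵐ x ∂μ, ‖f.1 x‖ ≤ 1 :=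
  eLpNorm_top_le_one_iff

/-- Complex conjugation on `L^∞(X)`. -/
def conjLinfty (f : Linfty 𝕜 μ) : Linfty 𝕜 μ :=
  ⟨star f.1, (memLp_congr_ae (AEEqFun.coeFn_star f.1)).2 f.2.star⟩

lemma coeFn_conjLinfty (f : Linfty 𝕜 μ) : (conjLinfty f).1 =ᵐ[μ] star (f.1 : X → 𝕜) :=
  AEEqFun.coeFn_star f.1

lemma conjLinfty_mul (f g : Linfty 𝕜 μ) :
    conjLinfty (f * g) = conjLinfty f * conjLinfty g := by
  refine Subtype.ext (AEEqFun.ext ?_)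
  filter_upwards [coeFn_conjLinfty f, coeFn_conjLinfty g, coeFn_conjLinfty (f * g),
    AEEqFun.coeFn_mul f.1 g.1, AEEqFun.coeFn_mul (conjLinfty f).1 (conjLinfty g).1]
    with x h1 h2 h3 h4 h5
  rw [h3, Pi.star_apply, Submonoid.coe_mul, Submonoid.coe_mul, h4, h5, Pi.mul_apply, Pi.mul_apply,
    h1, h2]
  simp

lemma conjLinfty_one : conjLinfty (1 : Linfty 𝕜 μ) = 1 := by
  refine Subtype.ext (AEEqFun.ext ?_)
  filter_upwards [coeFn_conjLinfty (1 : Linfty 𝕜 μ),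
    AEEqFun.coeFn_one (α := X) (μ := μ) (β := 𝕜)] with x h1 h2
  rw [h1, Pi.star_apply, Submonoid.coe_one, h2]
  simp

lemma conjLinfty_mem_unitBall {f : Linfty 𝕜 μ} (hf : f ∈ unitBall 𝕜 μ) :
    conjLinfty f ∈ unitBall 𝕜 μ := by
  rw [mem_unitBall_iff] at *
  filter_upwards [hf, coeFn_conjLinfty f] with x h1 h2
  simpa [h2] using h1

/-- Multiplication by a bounded function, as an operator on `L²(X)`. -/
def mulOp (u : Linfty 𝕜 μ) : Lp 𝕜 2 μ →L[𝕜] Lp 𝕜 2 μ :=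
  (ContinuousLinearMap.mul 𝕜 𝕜).holderL μ ∞ 2 2 ⟨u.1, Lp.mem_Lp_iff_memLp.2 u.2⟩

lemma coeFn_mulOp (u : Linfty 𝕜 μ) (v : Lp 𝕜 2 μ) :
    mulOp u v =ᵐ[μ] fun x => u.1 x * v x :=
  ContinuousLinearMap.coeFn_holder _ _ _

lemma norm_mulOp_le {u : Linfty 𝕜 μ} (hu : u ∈ unitBall 𝕜 μ) (v : Lp 𝕜 2 μ) :
    ‖mulOp u v‖ ≤ ‖v‖ := by
  rw [mem_unitBall_iff] at hu
  refine Lp.norm_le_norm_of_ae_le ?_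
  filter_upwards [hu, coeFn_mulOp u v] with x h1 h2
  rw [h2, norm_mul]
  exact mul_le_of_le_one_left (norm_nonneg _) h1

lemma inner_mulOp_right (u : Linfty 𝕜 μ) (v w : Lp 𝕜 2 μ) :
    inner 𝕜 v (mulOp u w) = inner 𝕜 (mulOp (conjLinfty u) v) w := by
  rw [L2.inner_def, L2.inner_def]
  refine integral_congr_ae ?_
  filter_upwards [coeFn_mulOp u w, coeFn_mulOp (conjLinfty u) v, coeFn_conjLinfty u]
    with x h1 h2 h3
  simp only [h1, h2, h3, RCLike.inner_apply, Pi.star_apply, map_mul, RCLike.star_def,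
    RCLike.conj_conj]
  ring

variable (𝕜 μ) in
/-- The elements of `L²(X)` with values in the closed unit disc. -/
def ballL2 : Set (Lp 𝕜 2 μ) := {u | ∀ᵐ x ∂μ, ‖u x‖ ≤ 1}

/-- A convergent sequence in `L²` has a subsequence that converges almost everywhere. With
convexity, this keeps averages of bounded functions in `L^∞`, where the action is multiplicative. -/
lemma isClosed_ballL2 : IsClosed (ballL2 𝕜 μ) := by
  refine IsSeqClosed.isClosed fun u v hu huv => ?_
  obtain ⟨ns, -, hns⟩ :=
    (tendstoInMeasure_of_tendsto_Lp huv).exists_seq_tendsto_ae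
  have hu' : ∀ᵐ x ∂μ, ∀ i, ‖u (ns i) x‖ ≤ 1 := ae_all_iff.2 fun i => hu (ns i)
  show ∀ᵐ x ∂μ, ‖v x‖ ≤ 1
  filter_upwards [hns, hu'] with x h1 h2
  exact le_of_tendsto' h1.norm h2

lemma convex_ballL2 : Convex ℝ (ballL2 𝕜 μ) := by
  intro u hu v hv a b ha hb hab
  show ∀ᵐ x ∂μ, ‖(a • u + b • v : Lp 𝕜 2 μ) x‖ ≤ 1
  filter_upwards [hu, hv, Lp.coeFn_add (a • u) (b • v), Lp.coeFn_smul a u, Lp.coeFn_smul b v]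
    with x h1 h2 h3 h4 h5
  rw [h3, Pi.add_apply, h4, h5]
  calc ‖a • u x + b • v x‖ ≤ ‖a • u x‖ + ‖b • v x‖ := norm_add_le _ _
    _ ≤ a * 1 + b * 1 := by
      rw [norm_smul, norm_smul, Real.norm_of_nonneg ha, Real.norm_of_nonneg hb]
      gcongr
    _ = 1 := by linarith

/-- The factor `1/2` normalizes a difference of two averages so that it can serve as a function from
the unit ball in a reduced system. -/
lemma half_sub_mem_ballL2 {u v : Lp 𝕜 2 μ} (hu : u ∈ ballL2 𝕜 μ) (hv : v ∈ ballL2 𝕜 μ) :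
    (2⁻¹ : ℝ) • (u - v) ∈ ballL2 𝕜 μ := by
  have hv' : -v ∈ ballL2 𝕜 μ := by
    show ∀ᵐ x ∂μ, ‖(-v : Lp 𝕜 2 μ) x‖ ≤ 1
    filter_upwards [hv, Lp.coeFn_neg v] with x h1 h2
    rwa [h2, Pi.neg_apply, norm_neg]
  have := convex_ballL2 hu hv' (a := 2⁻¹) (b := 2⁻¹) (by norm_num) (by norm_num) (by norm_num)
  rwa [← smul_add, ← sub_eq_add_neg] at this

variable [IsProbabilityMeasure μ]

lemma toL2_injective : Function.Injective (toL2 : Linfty 𝕜 μ → Lp 𝕜 2 μ) := by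
  intro f g h
  exact Subtype.ext (congrArg (fun u : Lp 𝕜 2 μ => (u : X →ₘ[μ] 𝕜)) h)

lemma mulOp_toL2 (u v : Linfty 𝕜 μ) : mulOp u (toL2 v) = toL2 (u * v) := by
  refine Lp.ext ?_
  filter_upwards [coeFn_mulOp u (toL2 v), AEEqFun.coeFn_mul u.1 v.1] with x h1 h2
  rw [h1]
  exact h2.symm

lemma norm_toL2_le_one {u : Linfty 𝕜 μ} (hu : u ∈ unitBall 𝕜 μ) : ‖toL2 u‖ ≤ 1 := by
  have := Lp.norm_le_of_ae_bound (f := toL2 u) (C := 1) zero_le_one (mem_unitBall_iff.1 hu)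
  simpa [measureUnivNNReal] using this

/-- Density of `L^∞` in `L²`, tested on indicator functions. -/
lemma eq_zero_of_forall_inner_toL2 {h : Lp 𝕜 2 μ}
    (H : ∀ f : Linfty 𝕜 μ, inner 𝕜 (toL2 f) h = 0) : h = 0 := by
  have hint : Integrable (h : X → 𝕜) μ := (Lp.memLp h).integrable (by norm_num)
  refine Lp.ext ?_
  refine EventuallyEq.trans ?_ (Lp.coeFn_zero _ _ _).symm
  refine ae_eq_zero_of_forall_setIntegral_eq_of_sigmaFinite
    (fun s _ _ => hint.integrableOn) fun s hs hμs => ?_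
  have hm : MemLp (s.indicator fun _ => (1 : 𝕜)) ∞ μ := memLp_top_const _ |>.indicator hs
  have h1 : indicatorConstLp 2 hs hμs.ne (1 : 𝕜) = toL2 ⟨AEEqFun.mk _ hm.1,
      (memLp_congr_ae (AEEqFun.coeFn_mk _ hm.1)).2 hm⟩ := by
    refine Lp.ext ?_
    refine indicatorConstLp_coeFn.trans ?_
    exact (AEEqFun.coeFn_mk _ hm.1).symm
  rw [← L2.inner_indicatorConstLp_one hs hμs.ne, h1, H]

lemma toL2_mem_ballL2 {u : Linfty 𝕜 μ} (hu : u ∈ unitBall 𝕜 μ) : toL2 u ∈ ballL2 𝕜 μ :=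
  mem_unitBall_iff.1 hu

lemma exists_toL2_eq {u : Lp 𝕜 2 μ} (hu : u ∈ ballL2 𝕜 μ) :
    ∃ v ∈ unitBall 𝕜 μ, toL2 v = u :=
  ⟨⟨u.1, memLp_top_of_bound (Lp.aestronglyMeasurable u) 1 hu⟩, mem_unitBall_iff.2 hu, rfl⟩

/-- The product of two strongly measurable maps into the unit ball is strongly measurable. -/
lemma aestronglyMeasurable_toL2_mul {Y : Type*} [MeasurableSpace Y] {ν : Measure Y}
    {φ ψ : Y → Linfty 𝕜 μ} (hφ : ∀ y, φ y ∈ unitBall 𝕜 μ) (hψ : ∀ y, ψ y ∈ unitBall 𝕜 μ)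
    (hφm : AEStronglyMeasurable (fun y => toL2 (φ y)) ν)
    (hψm : AEStronglyMeasurable (fun y => toL2 (ψ y)) ν) :
    AEStronglyMeasurable (fun y => toL2 (φ y * ψ y)) ν := by
  let T := {u : Lp 𝕜 2 μ // ∃ v ∈ unitBall 𝕜 μ, toL2 v = u}
  let lift : (φ : Y → Linfty 𝕜 μ) → (∀ y, φ y ∈ unitBall 𝕜 μ) → Y → T :=
    fun φ h y => ⟨toL2 (φ y), φ y, h y, rfl⟩
  have hl : ∀ φ h, AEStronglyMeasurable (fun y => toL2 (φ y)) ν →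
      AEStronglyMeasurable (lift φ h) ν := fun φ h hm =>
    (Topology.IsEmbedding.subtypeVal.aestronglyMeasurable_comp_iff (f := lift φ h)).1 hm
  -- Multiplication is jointly continuous for the `L²` norm once both factors are bounded by one,
  -- because `u'v' - uv = u'(v' - v) + v(u' - u)`. The representatives chosen here are unique since
  -- `toL2` is injective.
  let m : T × T → Lp 𝕜 2 μ := fun p => toL2 (p.1.property.choose * p.2.property.choose)
  have hm : ∀ (u v : Linfty 𝕜 μ) (hu : u ∈ unitBall 𝕜 μ) (hv : v ∈ unitBall 𝕜 μ),
      m (⟨toL2 u, u, hu, rfl⟩, ⟨toL2 v, v, hv, rfl⟩) = toL2 (u * v) := by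
    intro u v hu hv
    have h1 : ∀ (w : T) (u : Linfty 𝕜 μ), toL2 u = w.1 → w.property.choose = u := fun w u h =>
      toL2_injective (w.property.choose_spec.2.trans h.symm)
    show toL2 (_ * _) = _
    rw [h1 ⟨toL2 u, u, hu, rfl⟩ u rfl, h1 ⟨toL2 v, v, hv, rfl⟩ v rfl]
  have hcont : Continuous m := by
    rw [continuous_iff_continuousAt]
    rintro ⟨⟨_, u, hu, rfl⟩, ⟨_, v, hv, rfl⟩⟩
    rw [ContinuousAt, hm _ _ hu hv, tendsto_iff_norm_sub_tendsto_zero]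
    have hb : Tendsto (fun p : T × T => ‖p.2.1 - toL2 v‖ + ‖p.1.1 - toL2 u‖)
        (𝓝 (⟨toL2 u, u, hu, rfl⟩, ⟨toL2 v, v, hv, rfl⟩)) (𝓝 0) := by
      have : Continuous (fun p : T × T => ‖p.2.1 - toL2 v‖ + ‖p.1.1 - toL2 u‖) :=
        ((continuous_subtype_val.comp continuous_snd).sub continuous_const).norm.add
          ((continuous_subtype_val.comp continuous_fst).sub continuous_const).norm
      have h := this.tendsto (⟨toL2 u, u, hu, rfl⟩, ⟨toL2 v, v, hv, rfl⟩)
      simpa using h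
    refine squeeze_zero (fun _ => norm_nonneg _) ?_ hb
    rintro ⟨⟨_, u', hu', rfl⟩, ⟨_, v', hv', rfl⟩⟩
    rw [hm _ _ hu' hv']
    have e : toL2 (u' * v') - toL2 (u * v)
        = mulOp u' (toL2 v' - toL2 v) + mulOp v (toL2 u' - toL2 u) := by
      simp only [map_sub, mulOp_toL2, mul_comm v]
      abel
    rw [e]
    exact (norm_add_le _ _).trans (add_le_add (norm_mulOp_le hu' _) (norm_mulOp_le hv _))
  have := hcont.comp_aestronglyMeasurable ((hl φ hφ hφm).prodMk (hl ψ hψ hψm))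
  refine this.congr (Eventually.of_forall fun y => ?_)
  exact hm _ _ (hφ y) (hψ y)

end BoundedFunctions

/-! ### Strong measurability of evaluated operators. -/

section Measurability

/-- Evaluation of a strongly measurable family of isometries along a strongly measurable map. -/
lemma aestronglyMeasurable_apply {𝕜 E Y : Type*} [RCLike 𝕜] [NormedAddCommGroup E]
    [NormedSpace 𝕜 E] [MeasurableSpace Y] {ν : Measure Y} {V : Y → E ≃ₗᵢ[𝕜] E}
    (hV : ∀ f, AEStronglyMeasurable (fun y => V y f) ν) {w : Y → E}
    (hw : AEStronglyMeasurable w ν) : AEStronglyMeasurable (fun y => V y (w y)) ν := by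
  have hs : ∀ s : SimpleFunc Y E, AEStronglyMeasurable (fun y => V y (s y)) ν := by
    intro s
    induction s using SimpleFunc.induction with
    | @const c s hs =>
      refine ((hV c).indicator hs).congr (Eventually.of_forall fun y => ?_)
      by_cases hy : y ∈ s <;> simp [hy]
    | @add f g _ hf hg =>
      refine (hf.add hg).congr (Eventually.of_forall fun y => ?_)
      simp
  refine aestronglyMeasurable_of_tendsto_ae (u := atTop)
    (f := fun n y => V y (hw.stronglyMeasurable_mk.approx n y)) (fun n => hs _) ?_
  filter_upwards [hw.ae_eq_mk] with y hy
  rw [hy]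
  exact (V y).continuous.continuousAt.tendsto.comp
    (hw.stronglyMeasurable_mk.tendsto_approx y)

end Measurability

/-! ### The action on `L^∞` and products along lists of maps. -/

section Action

variable {𝕜 : Type*} [RCLike 𝕜] {X : Type*} [MeasurableSpace X] {μ : Measure X}
  [IsProbabilityMeasure μ]

section Single

variable {U : UnitaryOp 𝕜 μ} (hU : ActsOnLinfty U)

lemma toL2_actLinfty (f : Linfty 𝕜 μ) : toL2 (actLinfty U hU f) = U (toL2 f) := rfl

lemma actLinfty_mul (f g : Linfty 𝕜 μ) :
    actLinfty U hU (f * g) = actLinfty U hU f * actLinfty U hU g :=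
  Subtype.ext (hU.map_mul f g)

lemma actLinfty_mem_unitBall {f : Linfty 𝕜 μ} (hf : f ∈ unitBall 𝕜 μ) :
    actLinfty U hU f ∈ unitBall 𝕜 μ :=
  (hU.norm_map f).trans_le hf

lemma eq_zero_of_forall_inner_map_toL2 (U : UnitaryOp 𝕜 μ) {h : Lp 𝕜 2 μ}
    (H : ∀ f : Linfty 𝕜 μ, inner 𝕜 (U (toL2 f)) h = 0) : h = 0 := by
  have : U.symm h = 0 := eq_zero_of_forall_inner_toL2 fun f => by
    rw [← U.inner_map_map, U.apply_symm_apply, H]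
  simpa using this

/-- With `u = U 1`, multiplicativity gives `⟨conj u, U f⟩ = ⟨1, u · U f⟩ = ⟨1, U f⟩` for all bounded
`f`. The vectors `U f` are dense, hence `conj u = 1`. -/
lemma actLinfty_one : actLinfty U hU 1 = 1 := by
  have h0 : mulOp (conjLinfty (actLinfty U hU 1)) (toL2 (1 : Linfty 𝕜 μ)) - toL2 1 = 0 := by
    refine eq_zero_of_forall_inner_map_toL2 U fun f => ?_
    rw [inner_sub_right, sub_eq_zero, ← inner_conj_symm, ← inner_mulOp_right, ← toL2_actLinfty hU,
      mulOp_toL2, ← actLinfty_mul, one_mul, inner_conj_symm]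
  rw [mulOp_toL2, sub_eq_zero, mul_one] at h0
  have h1 := congrArg conjLinfty (toL2_injective h0)
  have h2 : conjLinfty (conjLinfty (actLinfty U hU 1)) = actLinfty U hU 1 :=
    Subtype.ext (star_star _)
  rw [← h2, h1, conjLinfty_one]

/-- Conjugation is determined by products and the inner product through `⟨b, conj a⟩ = ⟨a b, 1⟩`,
and `U` preserves both as well as `1`. -/
lemma actLinfty_conj (f : Linfty 𝕜 μ) :
    actLinfty U hU (conjLinfty f) = conjLinfty (actLinfty U hU f) := by
  refine toL2_injective (sub_eq_zero.1 (eq_zero_of_forall_inner_map_toL2 U fun g => ?_))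
  have key : ∀ a b : Linfty 𝕜 μ,
      inner 𝕜 (toL2 b) (toL2 (conjLinfty a)) = inner 𝕜 (toL2 (a * b)) (toL2 1) := by
    intro a b
    rw [← inner_conj_symm, ← mul_one (conjLinfty a), ← mulOp_toL2 (conjLinfty a),
      ← inner_mulOp_right, mulOp_toL2, inner_conj_symm]
  rw [inner_sub_right, sub_eq_zero, toL2_actLinfty, U.inner_map_map, key, ← toL2_actLinfty hU g,
    key, ← actLinfty_mul, toL2_actLinfty, ← U.inner_map_map, ← toL2_actLinfty hU 1, actLinfty_one]

end Single

variable {G : Subgroup (UnitaryOp 𝕜 μ)} (hG : ∀ U ∈ G, ActsOnLinfty U)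

/-- The action of an element of `G` on `L^∞(X)`. -/
def act (k : G) : Linfty 𝕜 μ →* Linfty 𝕜 μ where
  toFun := actLinfty k.1 (hG _ k.2)
  map_one' := actLinfty_one _
  map_mul' := actLinfty_mul _

lemma toL2_act (k : G) (f : Linfty 𝕜 μ) : toL2 (act hG k f) = k.1 (toL2 f) := rfl

lemma act_mem_unitBall (k : G) {f : Linfty 𝕜 μ} (hf : f ∈ unitBall 𝕜 μ) :
    act hG k f ∈ unitBall 𝕜 μ := actLinfty_mem_unitBall (hG _ k.2) hf

lemma act_conj (k : G) (f : Linfty 𝕜 μ) :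
    act hG k (conjLinfty f) = conjLinfty (act hG k f) := actLinfty_conj (hG _ k.2) f

lemma act_mul (k l : G) (f : Linfty 𝕜 μ) : act hG (k * l) f = act hG k (act hG l f) :=
  toL2_injective rfl

lemma act_one (f : Linfty 𝕜 μ) : act hG 1 f = f := toL2_injective rfl

variable {Γ : Type*}

/-- The product `n ↦ ∏ ψ(n) f` over a list of pairs `(ψ, f)`. -/
def listProd (L : List ((Γ → G) × Linfty 𝕜 μ)) (n : Γ) : Linfty 𝕜 μ :=
  (L.map fun p => act hG (p.1 n) p.2).prod

lemma listProd_append (L L' : List ((Γ → G) × Linfty 𝕜 μ)) (n : Γ) :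
    listProd hG (L ++ L') n = listProd hG L n * listProd hG L' n := by
  simp [listProd]

lemma listProd_cons (p : (Γ → G) × Linfty 𝕜 μ) (L : List ((Γ → G) × Linfty 𝕜 μ)) (n : Γ) :
    listProd hG (p :: L) n = act hG (p.1 n) p.2 * listProd hG L n := by
  simp [listProd]

lemma listProd_mem_unitBall {L : List ((Γ → G) × Linfty 𝕜 μ)}
    (hL : ∀ p ∈ L, p.2 ∈ unitBall 𝕜 μ) (n : Γ) : listProd hG L n ∈ unitBall 𝕜 μ := by
  refine Submonoid.list_prod_mem _ fun x hx => ?_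
  obtain ⟨p, hp, rfl⟩ := List.mem_map.1 hx
  exact act_mem_unitBall hG _ (hL p hp)

lemma conj_listProd (L : List ((Γ → G) × Linfty 𝕜 μ)) (n : Γ) :
    conjLinfty (listProd hG L n)
      = listProd hG (L.map fun p => (p.1, conjLinfty p.2)) n := by
  induction L with
  | nil => exact conjLinfty_one
  | cons p L ih => rw [List.map_cons, listProd_cons, listProd_cons, conjLinfty_mul, ih, act_conj]

lemma act_listProd (k : G) (L : List ((Γ → G) × Linfty 𝕜 μ)) (n : Γ) :
    act hG k (listProd hG L n) = (L.map fun p => act hG (k * p.1 n) p.2).prod := by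
  induction L with
  | nil => exact map_one _
  | cons p L ih => rw [listProd_cons, map_mul, ih, List.map_cons, List.prod_cons, act_mul]

/-- The product over a list with entries from `g' ++ [h]` is a product over a list with entries
from `g'`, times a single term `h(n) f`. -/
lemma exists_listProd_eq_mul (g' : List (Γ → G)) (h : Γ → G)
    (L : List ((Γ → G) × Linfty 𝕜 μ)) (hL : ∀ p ∈ L, p.1 ∈ g' ++ [h] ∧ p.2 ∈ unitBall 𝕜 μ) :
    ∃ (L' : List ((Γ → G) × Linfty 𝕜 μ)) (f : Linfty 𝕜 μ),
      (∀ p ∈ L', p.1 ∈ g' ∧ p.2 ∈ unitBall 𝕜 μ) ∧ f ∈ unitBall 𝕜 μ ∧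
      ∀ n, listProd hG L n = listProd hG L' n * act hG (h n) f := by
  induction L with
  | nil => exact ⟨[], 1, by simp, one_mem _, fun n => by simp [listProd]⟩
  | cons p L ih =>
    obtain ⟨L', f, h1, h2, h3⟩ := ih fun q hq => hL q (List.mem_cons_of_mem _ hq)
    obtain ⟨hp1, hp2⟩ := hL p List.mem_cons_self
    rcases List.mem_append.1 hp1 with hp | hp
    · refine ⟨p :: L', f, ?_, h2, fun n => ?_⟩
      · intro q hq
        rcases List.mem_cons.1 hq with rfl | hq
        exacts [⟨hp, hp2⟩, h1 q hq]
      · rw [listProd_cons, listProd_cons, h3, mul_assoc]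
    -- Since `h(n)` is multiplicative, all factors along `h` merge into one.
    · refine ⟨L', p.2 * f, h1, mul_mem hp2 h2, fun n => ?_⟩
      rw [listProd_cons, h3, map_mul, List.mem_singleton.1 hp, mul_left_comm]

variable [TopologicalSpace Γ] [MeasurableSpace Γ] {ν : Measure Γ}

lemma MeasurableMap.aestronglyMeasurable_act {ψ : Γ → G} (hψ : MeasurableMap ν G ψ) {K : Set Γ}
    (hK : IsCompact K) {w : Γ → Linfty 𝕜 μ}
    (hw : AEStronglyMeasurable (fun n => toL2 (w n)) (ν.restrict K)) :
    AEStronglyMeasurable (fun n => toL2 (act hG (ψ n) (w n))) (ν.restrict K) :=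
  aestronglyMeasurable_apply (V := fun n => (ψ n).1) (fun f => (hψ K hK f).1) hw

lemma MeasurableMap.aestronglyMeasurable_inv_act {ψ : Γ → G} (hψ : MeasurableMap ν G ψ)
    {K : Set Γ} (hK : IsCompact K) {w : Γ → Linfty 𝕜 μ}
    (hw : AEStronglyMeasurable (fun n => toL2 (w n)) (ν.restrict K)) :
    AEStronglyMeasurable (fun n => toL2 (act hG (ψ n)⁻¹ (w n))) (ν.restrict K) :=
  aestronglyMeasurable_apply (V := fun n => ((ψ n)⁻¹ : G).1) (fun f => (hψ K hK f).2) hw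

lemma aestronglyMeasurable_listProd {L : List ((Γ → G) × Linfty 𝕜 μ)}
    (hL : ∀ p ∈ L, MeasurableMap ν G p.1 ∧ p.2 ∈ unitBall 𝕜 μ) {K : Set Γ} (hK : IsCompact K) :
    AEStronglyMeasurable (fun n => toL2 (listProd hG L n)) (ν.restrict K) := by
  induction L with
  | nil => exact aestronglyMeasurable_const (b := toL2 (1 : Linfty 𝕜 μ))
  | cons p L ih =>
    have hL' : ∀ q ∈ L, MeasurableMap ν G q.1 ∧ q.2 ∈ unitBall 𝕜 μ :=
      fun q hq => hL q (List.mem_cons_of_mem _ hq)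
    obtain ⟨hp1, hp2⟩ := hL p List.mem_cons_self
    simp only [listProd_cons]
    exact aestronglyMeasurable_toL2_mul (fun n => act_mem_unitBall hG _ hp2)
      (fun n => listProd_mem_unitBall hG (fun q hq => (hL' q hq).2) n)
      (hp1.aestronglyMeasurable_act hG hK aestronglyMeasurable_const) (ih hL')

end Action

/-! ### Translates of Haar measure and approximation by continuous functions. -/

section HaarMeasure

open Measure
open scoped Pointwise

variable {Γ : Type*} [Group Γ] [TopologicalSpace Γ] [IsTopologicalGroup Γ]
  [LocallyCompactSpace Γ] [MeasurableSpace Γ] [BorelSpace Γ] (ν : Measure Γ) [ν.IsHaarMeasure]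

/-- Left translation preserves `ν`, and right translation gives another left Haar measure. As `ν`
need not be regular, the two are compared only on sets with compact closure. -/
lemma map_mul_mul_apply (a b : Γ) {s : Set Γ} (hs : IsCompact (closure s)) :
    map (fun x => a * x * b) ν s = modularCharacterFun b • ν s := by
  have h : map (fun x => a * x * b) ν = map (· * b) ν := by
    have h1 : (fun x => a * x * b) = (· * b) ∘ (a * ·) := rfl
    rw [h1, ← map_map (measurable_mul_const b) (measurable_const_mul a), map_mul_left_eq_self]
  rw [h, modularCharacterFun_eq_haarScalarFactor ν b]
  exact measure_isMulInvariant_eq_smul_of_isCompact_closure _ _ hs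

lemma map_mul_mul_restrict [T2Space Γ] (a b : Γ) {W : Set Γ} (hW : IsCompact W) :
    (map (fun x => a * x * b) ν).restrict W = modularCharacterFun b • ν.restrict W := by
  ext s hs
  rw [restrict_apply hs, map_mul_mul_apply ν a b (hW.closure_of_subset Set.inter_subset_right),
    Measure.smul_apply, restrict_apply hs]

/-- The modular factor of `b` is the ratio of the measures of `V b⁻¹` and `V`, and `V b⁻¹` stays in
the compact set `V B⁻¹`. -/
lemma exists_modularCharacterFun_le {B : Set Γ} (hB : IsCompact B) :
    ∃ C : NNReal, ∀ b ∈ B, modularCharacterFun b ≤ C := by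
  borelize Γ
  let ν : Measure Γ := haar
  obtain ⟨V, hV, hV1⟩ := exists_compact_mem_nhds (1 : Γ)
  have hpos : ν (closure V) ≠ 0 :=
    (measure_pos_of_mem_nhds ν (mem_of_superset hV1 subset_closure)).ne'
  have hfin : ν (closure V) ≠ ∞ := hV.closure.measure_ne_top
  have hfin' : ν (closure V * B⁻¹) ≠ ∞ := (hV.closure.mul hB.inv).measure_ne_top
  refine ⟨(ν (closure V * B⁻¹) / ν (closure V)).toNNReal, fun b hb => ?_⟩
  have h := map_mul_mul_apply ν 1 b (s := closure V) (by simpa using hV.closure)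
  have h2 : map (fun x => 1 * x * b) ν (closure V) ≤ ν (closure V * B⁻¹) := by
    rw [map_apply (by fun_prop) isClosed_closure.measurableSet]
    refine measure_mono fun x hx => ?_
    exact ⟨x * b, by simpa using hx, b⁻¹, Set.inv_mem_inv.2 hb, by simp⟩
  rw [h, ENNReal.smul_def, smul_eq_mul, ← ENNReal.le_div_iff_mul_le (Or.inl hpos) (Or.inl hfin)]
    at h2
  rw [← ENNReal.coe_le_coe, ENNReal.coe_toNNReal (ENNReal.div_ne_top hfin' hpos)]
  exact h2

variable {E : Type*} [NormedAddCommGroup E] [NormedSpace ℝ E]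

/-- Continuous functions are dense in `L¹` of a regular measure on a locally compact space, which
need not be normal. -/
lemma exists_continuous_eLpNorm_sub_le {Y : Type*} [TopologicalSpace Y] [T2Space Y]
    [LocallyCompactSpace Y] [MeasurableSpace Y] [BorelSpace Y] (ρ : Measure Y) [ρ.Regular]
    {f : Y → E} (hf : MemLp f 1 ρ) {ε : ℝ≥0∞} (hε : ε ≠ 0) :
    ∃ g : Y → E, eLpNorm (f - g) 1 ρ ≤ ε ∧ Continuous g := by
  suffices H : ∃ g : Y → E, eLpNorm (f - g) 1 ρ ≤ ε ∧ Continuous g ∧ AEStronglyMeasurable g ρ by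
    obtain ⟨g, h1, h2, -⟩ := H
    exact ⟨g, h1, h2⟩
  refine hf.induction_dense (by simp) _ ?_ ?_ ?_ hε
  · intro c t ht htρ ε hε
    obtain ⟨η, ηpos, hη⟩ := exists_eLpNorm_indicator_le (p := 1) (μ := ρ) (by simp) c hε
    have hη2 : ((η / 2 : NNReal) : ℝ≥0∞) ≠ 0 := by simpa using ηpos.ne'
    obtain ⟨s, st, s_compact, -, hs⟩ := ht.exists_isCompact_isClosed_sdiff_lt htρ.ne hη2
    obtain ⟨V, tV, V_open, -, hV⟩ := ht.exists_isOpen_sdiff_lt htρ.ne hη2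
    obtain ⟨g, hg1, hg0, -, hg⟩ := exists_continuous_one_zero_of_isCompact s_compact
      V_open.isClosed_compl (disjoint_compl_right_iff.2 (st.trans tV))
    refine ⟨fun y => g y • c, ?_, by fun_prop,
      g.continuous.aestronglyMeasurable.smul aestronglyMeasurable_const⟩
    -- The cutoff `g` differs from the indicator of `t` only on `V \ s`.
    have hle : ρ (V \ s) ≤ η := by
      calc ρ (V \ s) ≤ ρ ((t \ s) ∪ (V \ t)) := measure_mono fun y hy => by
            by_cases h : y ∈ t
            exacts [Or.inl ⟨h, hy.2⟩, Or.inr ⟨hy.1, h⟩]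
        _ ≤ ρ (t \ s) + ρ (V \ t) := measure_union_le _ _
        _ ≤ (η / 2 : NNReal) + (η / 2 : NNReal) := add_le_add hs.le hV.le
        _ = η := by rw [← ENNReal.coe_add, add_halves]
    refine (eLpNorm_mono fun y => ?_).trans (hη _ hle)
    have hgc : ‖g y • c‖ ≤ ‖c‖ := by
      rw [norm_smul, Real.norm_of_nonneg (hg y).1]
      exact mul_le_of_le_one_left (norm_nonneg _) (hg y).2
    have hgc' : ‖g y • c - c‖ ≤ ‖c‖ := by
      have : g y • c - c = (g y - 1) • c := by rw [sub_smul, one_smul]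
      rw [this, norm_smul]
      refine mul_le_of_le_one_left (norm_nonneg _) ?_
      rw [Real.norm_eq_abs, abs_le]
      constructor <;> linarith [(hg y).1, (hg y).2]
    by_cases h1 : y ∈ s
    · simp [st h1, hg1 h1, h1]
    · by_cases h2 : y ∈ V
      · by_cases h3 : y ∈ t <;> simp [h1, h2, h3, hgc, hgc']
      · have h3 : y ∉ t := fun h => h2 (tV h)
        simp [h1, h2, h3, hg0 (show y ∈ Vᶜ from h2)]
  · rintro f g ⟨hf, hf'⟩ ⟨hg, hg'⟩
    exact ⟨hf.add hg, hf'.add hg'⟩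
  · exact fun f hf => hf.2

/-- On a compact set `ν` is a positive multiple of the regular measure `haar`, to which the density
of continuous functions applies. -/
lemma exists_continuous_lintegral_sub_le [T2Space Γ] {S : Γ → E} (hS : ∀ n, ‖S n‖ ≤ 1)
    {W : Set Γ} (hW : IsCompact W) (hSm : AEStronglyMeasurable S (ν.restrict W)) {η : ℝ≥0∞}
    (hη : η ≠ 0) :
    ∃ S' : Γ → E, Continuous S' ∧ ∫⁻ n in W, ‖S n - S' n‖ₑ ∂ν ≤ η := by
  let c := haarScalarFactor ν haar
  have hc : c ≠ 0 := (haarScalarFactor_pos_of_isHaarMeasure ν haar).ne'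
  have hr : ν.restrict W = c • (haar : Measure Γ).restrict W := by
    ext s hs
    rw [restrict_apply hs, Measure.smul_apply, restrict_apply hs]
    exact measure_isMulInvariant_eq_smul_of_isCompact_closure _ _
      (hW.closure_of_subset Set.inter_subset_right)
  rw [hr] at hSm ⊢
  have hac : (haar : Measure Γ).restrict W ≪ c • (haar : Measure Γ).restrict W := by
    refine AbsolutelyContinuous.mk fun s _ h => ?_
    rw [Measure.smul_apply, ENNReal.smul_def, smul_eq_mul, mul_eq_zero] at h
    exact h.resolve_left (by simpa using hc)
  have hSm' : AEStronglyMeasurable S ((haar : Measure Γ).restrict W) := hSm.mono_ac hac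
  have hmem : MemLp S 1 ((haar : Measure Γ).restrict W) := by
    have : IsFiniteMeasure ((haar : Measure Γ).restrict W) :=
      isFiniteMeasure_restrict.2 hW.measure_ne_top
    exact MemLp.of_bound hSm' 1 (Eventually.of_forall hS)
  rw [← memLp_indicator_iff_restrict hW.measurableSet] at hmem
  obtain ⟨S', h1, h2⟩ := exists_continuous_eLpNorm_sub_le haar hmem
    (ENNReal.div_ne_zero.2 ⟨hη, by simp⟩ : η / c ≠ 0)
  refine ⟨S', h2, ?_⟩
  have h3 : ∫⁻ n in W, ‖S n - S' n‖ₑ ∂haar ≤ η / c := by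
    rw [eLpNorm_one_eq_lintegral_enorm] at h1
    refine le_trans ?_ ((setLIntegral_le_lintegral W _).trans h1)
    refine (setLIntegral_congr_fun hW.measurableSet fun n hn => ?_).le
    simp [hn]
  rw [lintegral_smul_measure, ENNReal.smul_def, smul_eq_mul]
  calc (c : ℝ≥0∞) * ∫⁻ n in W, ‖S n - S' n‖ₑ ∂haar ≤ c * (η / c) := by gcongr
    _ = η := ENNReal.mul_div_cancel (by simpa using hc) (by simp)

/-- The average of a function over a set. -/
def avg (I : Set Γ) (S : Γ → E) : E := ((ν I).toReal)⁻¹ • ∫ n in I, S n ∂ν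

end HaarMeasure

/-! ### Averages over almost invariant sets as convex combinations of translates. -/

section ConvexApproximation

open Measure

variable {Γ : Type*} [Group Γ] [TopologicalSpace Γ] [IsTopologicalGroup Γ]
  [LocallyCompactSpace Γ] [T2Space Γ] [MeasurableSpace Γ] [BorelSpace Γ] (ν : Measure Γ)
  [ν.IsHaarMeasure] {E : Type*} [NormedAddCommGroup E] [NormedSpace ℝ E]

lemma integrableOn_of_norm_le_one {S : Γ → E} (hS : ∀ n, ‖S n‖ ≤ 1) {W : Set Γ}
    (hW : IsCompact W) (hSm : AEStronglyMeasurable S (ν.restrict W)) : IntegrableOn S W ν :=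
  IntegrableOn.of_bound hW.measure_lt_top hSm 1 (Eventually.of_forall hS)

lemma enorm_setIntegral_sub_le {S : Γ → E} (hS : ∀ n, ‖S n‖ ≤ 1) {F D : Set Γ}
    (hF : IsCompact F) (hD : IsCompact D) (hFm : AEStronglyMeasurable S (ν.restrict F))
    (hDm : AEStronglyMeasurable S (ν.restrict D)) :
    ‖∫ n in F, S n ∂ν - ∫ n in D, S n ∂ν‖ₑ ≤ ν (symmDiff D F) := by
  rw [← integral_indicator hF.measurableSet, ← integral_indicator hD.measurableSet,
    ← integral_sub ((integrable_indicator_iff hF.measurableSet).2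
      (integrableOn_of_norm_le_one ν hS hF hFm)) ((integrable_indicator_iff hD.measurableSet).2
      (integrableOn_of_norm_le_one ν hS hD hDm))]
  refine (enorm_integral_le_lintegral_enorm _).trans ?_
  have hm : MeasurableSet (symmDiff D F) := hD.measurableSet.symmDiff hF.measurableSet
  rw [← lintegral_indicator_one hm]
  refine lintegral_mono fun n => ?_
  have hn : ‖S n‖ₑ ≤ 1 := by
    rw [← ofReal_norm]
    exact ENNReal.ofReal_le_one.2 (hS n)
  by_cases h1 : n ∈ F <;> by_cases h2 : n ∈ D <;> simp [h1, h2, Set.mem_symmDiff, hn]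

/-- Passing from `F` to `cF` costs `δ`, replacing `S` by `S'` on `cF` costs `η`, and left invariance
pulls the integral over `cF` back to `F`. -/
lemma enorm_avg_sub_avg_translate_le {S S' : Γ → E} (hS : ∀ n, ‖S n‖ ≤ 1) (hS' : Continuous S')
    {F : Set Γ} (hF : IsCompact F) (hF0 : ν F ≠ 0) (c : Γ)
    (hFm : AEStronglyMeasurable S (ν.restrict F))
    (hDm : AEStronglyMeasurable S (ν.restrict ((fun n => c * n) '' F))) {δ η : ℝ≥0∞}
    (hδ : ν (symmDiff ((fun n => c * n) '' F) F) ≤ δ * ν F)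
    (hη : ∫⁻ n in (fun n => c * n) '' F, ‖S n - S' n‖ₑ ∂ν ≤ η * ν F) :
    ‖avg ν F S - avg ν F (fun n => S' (c * n))‖ₑ ≤ δ + η := by
  have hFt : ν F ≠ ∞ := hF.measure_ne_top
  have hD : IsCompact ((fun n => c * n) '' F) := hF.image (by fun_prop)
  have e : ∫ n in F, S' (c * n) ∂ν = ∫ n in (fun n => c * n) '' F, S' n ∂ν :=
    ((measurePreserving_mul_left ν c).setIntegral_image_emb (measurableEmbedding_mulLeft c)
      S' F).symm
  have h1 : ‖∫ n in F, S n ∂ν - ∫ n in F, S' (c * n) ∂ν‖ₑ ≤ (δ + η) * ν F := by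
    rw [e]
    calc _ = ‖(∫ n in F, S n ∂ν - ∫ n in (fun n => c * n) '' F, S n ∂ν)
          + (∫ n in (fun n => c * n) '' F, S n ∂ν - ∫ n in (fun n => c * n) '' F, S' n ∂ν)‖ₑ := by
            rw [sub_add_sub_cancel]
      _ ≤ _ := enorm_add_le _ _
      _ ≤ δ * ν F + η * ν F := by
        refine add_le_add ((enorm_setIntegral_sub_le ν hS hF hD hFm hDm).trans hδ) ?_
        rw [← integral_sub (integrableOn_of_norm_le_one ν hS hD hDm)
          (hS'.continuousOn.integrableOn_compact hD)]
        exact (enorm_integral_le_lintegral_enorm _).trans hη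
      _ = (δ + η) * ν F := by ring
  rw [avg, avg, ← smul_sub, enorm_smul, enorm_inv (ENNReal.toReal_ne_zero.2 ⟨hF0, hFt⟩),
    Real.enorm_of_nonneg ENNReal.toReal_nonneg, ENNReal.ofReal_toReal hFt, mul_comm,
    ← div_eq_mul_inv]
  exact ENNReal.div_le_of_le_mul h1

/-- The average is taken in the Banach space `C(K, E)`, where it lies in the closed convex hull of
the values. This yields one convex combination that works uniformly in `l ∈ K`. -/
lemma exists_convexCombination_continuous [CompleteSpace E] {S : Γ → E} (hS : Continuous S)
    {F K : Set Γ} (hF : IsCompact F) (hF0 : ν F ≠ 0) (hK : IsCompact K) {c : Γ → Γ}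
    (hc : Continuous c) {η : ℝ≥0∞} (hη : η ≠ 0) :
    ∃ (ι : Type) (t : Finset ι) (w : ι → ℝ) (z : ι → Γ), (∀ i ∈ t, 0 ≤ w i ∧ z i ∈ F) ∧
      ∑ i ∈ t, w i = 1 ∧
      ∀ l ∈ K, ‖avg ν F (fun n => S (c l * n)) - ∑ i ∈ t, w i • S (c l * z i)‖ₑ ≤ η := by
  have : CompactSpace K := isCompact_iff_compactSpace.1 hK
  let Ψ : C(Γ × K, E) := ⟨fun p => S (c p.2 * p.1), by fun_prop⟩
  let Φ : C(Γ, C(K, E)) := Ψ.curry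
  have hint : IntegrableOn Φ F ν := Φ.continuous.continuousOn.integrableOn_compact hF
  have hmem : ⨍ n in F, Φ n ∂ν ∈ closure (convexHull ℝ (Φ '' F)) :=
    (convex_convexHull ℝ _).set_average_mem_closure hF0 hF.measure_ne_top
      ((ae_restrict_iff' hF.measurableSet).2 (Eventually.of_forall fun n hn =>
        subset_convexHull ℝ _ (Set.mem_image_of_mem _ hn))) hint
  obtain ⟨b, hb, hbη⟩ := EMetric.mem_closure_iff.1 hmem η (pos_iff_ne_zero.2 hη)
  rw [convexHull_eq] at hb
  obtain ⟨ι, t, w, z, hw, hw1, hz, rfl⟩ := hb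
  have hz' : ∀ i, ∃ n, i ∈ t → n ∈ F ∧ Φ n = z i := fun i => by
    by_cases hi : i ∈ t
    · obtain ⟨n, h⟩ := hz i hi
      exact ⟨n, fun _ => h⟩
    · exact ⟨1, fun h => absurd h hi⟩
  choose y hy using hz'
  refine ⟨ι, t, w, y, fun i hi => ⟨hw i hi, (hy i hi).1⟩, hw1, fun l hl => ?_⟩
  have h1 : avg ν F (fun n => S (c l * n)) = (⨍ n in F, Φ n ∂ν) ⟨l, hl⟩ := by
    rw [setAverage_eq, ContinuousMap.smul_apply, ← ContinuousMap.evalCLM_apply ℝ,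
      ← ContinuousLinearMap.integral_comp_comm _ hint]
    rfl
  have h2 : ∑ i ∈ t, w i • S (c l * y i) = (t.centerMass w z) ⟨l, hl⟩ := by
    rw [Finset.centerMass_eq_of_sum_1 _ _ hw1, ContinuousMap.sum_apply]
    refine Finset.sum_congr rfl fun i hi => ?_
    rw [ContinuousMap.smul_apply, ← (hy i hi).2]
    rfl
  rw [h1, h2, ← edist_eq_enorm_sub]
  refine le_trans ?_ hbη.le
  rw [edist_dist, edist_dist]
  exact ENNReal.ofReal_le_ofReal (ContinuousMap.dist_apply_le_dist _)

lemma lintegral_translate_le {φ : Γ → ℝ≥0∞} {W K : Set Γ} (hW : IsCompact W)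
    (hφ : AEMeasurable φ (ν.restrict W)) (a b : Γ) (hKW : ∀ l ∈ K, a * l * b ∈ W)
    (hK : IsCompact K) :
    AEMeasurable (fun l => φ (a * l * b)) (ν.restrict K) ∧
      ∫⁻ l in K, φ (a * l * b) ∂ν ≤ modularCharacterFun b * ∫⁻ n in W, φ n ∂ν := by
  have hm : AEMeasurable φ ((map (fun x => a * x * b) ν).restrict W) := by
    rw [map_mul_mul_restrict ν a b hW]
    exact hφ.smul_measure _
  have hm' : AEMeasurable (W.indicator φ) (map (fun x => a * x * b) ν) :=
    (aemeasurable_indicator_iff hW.measurableSet).2 hm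
  have hcomp : AEMeasurable (fun l => W.indicator φ (a * l * b)) ν :=
    hm'.comp_measurable (by fun_prop)
  have heq : Set.EqOn (fun l => W.indicator φ (a * l * b)) (fun l => φ (a * l * b)) K :=
    fun l hl => by simp [hKW l hl]
  refine ⟨hcomp.restrict.congr ((ae_restrict_iff' hK.measurableSet).2
    (Eventually.of_forall heq)), ?_⟩
  calc ∫⁻ l in K, φ (a * l * b) ∂ν = ∫⁻ l in K, W.indicator φ (a * l * b) ∂ν :=
        (setLIntegral_congr_fun hK.measurableSet heq).symm
    _ ≤ ∫⁻ l, W.indicator φ (a * l * b) ∂ν := setLIntegral_le_lintegral _ _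
    _ = ∫⁻ n, W.indicator φ n ∂(map (fun x => a * x * b) ν) :=
        (lintegral_map' hm' (by fun_prop)).symm
    _ = ∫⁻ n in W, φ n ∂(map (fun x => a * x * b) ν) := lintegral_indicator hW.measurableSet _
    _ = modularCharacterFun b * ∫⁻ n in W, φ n ∂ν := by
      rw [map_mul_mul_restrict ν a b hW, lintegral_smul_measure]
      rfl

/-- If `F` is almost invariant under left translation by `a l a⁻¹`, `l ∈ K`, then the average of `S`
over `F` is close in `L¹(K)` to a convex combination of the functions `l ↦ S(a l a⁻¹ n)`, `n ∈ F`.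
-/
lemma exists_convexCombination [CompleteSpace E] {S : Γ → E} (hS : ∀ n, ‖S n‖ ≤ 1)
    (hSm : ∀ W, IsCompact W → AEStronglyMeasurable S (ν.restrict W)) {F K : Set Γ}
    (hF : IsCompact F) (hF0 : ν F ≠ 0) (hK : IsCompact K) (a : Γ) {δ η : ℝ≥0∞}
    (hinv : ∀ l ∈ K, ν (symmDiff ((fun n => a * l * a⁻¹ * n) '' F) F) ≤ δ * ν F)
    (hη : η ≠ 0) :
    ∃ (ι : Type) (t : Finset ι) (w : ι → ℝ) (z : ι → Γ), (∀ i ∈ t, 0 ≤ w i ∧ z i ∈ F) ∧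
      ∑ i ∈ t, w i = 1 ∧ ∀ I ⊆ K,
      ∫⁻ l in I, ‖avg ν F S - ∑ i ∈ t, w i • S (a * l * a⁻¹ * z i)‖ₑ ∂ν
        ≤ (δ + η) * ν I + η := by
  let W : Set Γ := F ∪ (fun p : Γ × Γ => a * p.1 * a⁻¹ * p.2) '' (K ×ˢ F)
  have hW : IsCompact W := hF.union ((hK.prod hF).image (by fun_prop))
  have hcW : ∀ l ∈ K, (fun n => a * l * a⁻¹ * n) '' F ⊆ W := by
    rintro l hl _ ⟨n, hn, rfl⟩
    exact Or.inr ⟨(l, n), ⟨hl, hn⟩, rfl⟩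
  obtain ⟨C, hC⟩ := exists_modularCharacterFun_le
    (hF.image (f := fun n => a⁻¹ * n) (by fun_prop))
  have hFt : ν F ≠ ∞ := hF.measure_ne_top
  have hη2 : η / 2 ≠ 0 := ENNReal.div_ne_zero.2 ⟨hη, by simp⟩
  have hC0 : η / (C + 1) ≠ 0 := ENNReal.div_ne_zero.2 ⟨hη, by simp⟩
  -- The first bound controls the error inside averages over the translates of `F`. The second
  -- controls the `L¹(K)` error of `l ↦ S(a l a⁻¹ z)`, which right translation by `a⁻¹ z` magnifies
  -- at most `C` times.
  obtain ⟨S', hS', hSS'⟩ := exists_continuous_lintegral_sub_le ν hS hW (hSm W hW)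
    (η := min (η / 2 * ν F) (η / (C + 1))) (by simp [hη2, hF0, hC0])
  obtain ⟨ι, t, w, z, hwz, hw1, happ⟩ := exists_convexCombination_continuous ν hS' hF hF0 hK
    (c := fun l => a * l * a⁻¹) (by fun_prop) hη2
  refine ⟨ι, t, w, z, hwz, hw1, fun I hIK => ?_⟩
  have hφ : AEMeasurable (fun n => ‖S n - S' n‖ₑ) (ν.restrict W) :=
    ((hSm W hW).sub (hS'.continuousOn.aestronglyMeasurable_of_isCompact hW
      hW.measurableSet)).enorm
  have hz : ∀ i ∈ t, AEMeasurable (fun l => ‖S (a * l * (a⁻¹ * z i)) - S' (a * l * (a⁻¹ * z i))‖ₑ)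
      (ν.restrict K) ∧ ∫⁻ l in K, ‖S (a * l * (a⁻¹ * z i)) - S' (a * l * (a⁻¹ * z i))‖ₑ ∂ν ≤ η := by
    intro i hi
    obtain ⟨h1, h2⟩ := lintegral_translate_le ν hW hφ a (a⁻¹ * z i) (K := K)
      (fun l hl => hcW l hl ⟨z i, (hwz i hi).2, by simp only [mul_assoc]⟩) hK
    refine ⟨h1, h2.trans ?_⟩
    calc (modularCharacterFun (a⁻¹ * z i) : ℝ≥0∞) * ∫⁻ n in W, ‖S n - S' n‖ₑ ∂ν
        ≤ (C + 1) * (η / (C + 1)) := by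
          gcongr
          · exact (ENNReal.coe_le_coe.2 (hC _ ⟨z i, (hwz i hi).2, rfl⟩)).trans le_self_add
          · exact hSS'.trans (min_le_right _ _)
      _ ≤ η := ENNReal.mul_div_le
  have hpt : ∀ l ∈ K, ‖avg ν F S - ∑ i ∈ t, w i • S (a * l * a⁻¹ * z i)‖ₑ ≤ (δ + η) +
      ∑ i ∈ t, ENNReal.ofReal (w i) *
        ‖S (a * l * (a⁻¹ * z i)) - S' (a * l * (a⁻¹ * z i))‖ₑ := by
    intro l hl
    have h1 := enorm_avg_sub_avg_translate_le ν hS hS' hF hF0 (a * l * a⁻¹) (hSm F hF)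
      (hSm _ (hF.image (by fun_prop))) (hinv l hl) (η := η / 2)
      (((lintegral_mono_set (hcW l hl)).trans hSS').trans (min_le_left _ _))
    have h2 := happ l hl
    have h3 : ‖∑ i ∈ t, w i • S' (a * l * a⁻¹ * z i) - ∑ i ∈ t, w i • S (a * l * a⁻¹ * z i)‖ₑ
        ≤ ∑ i ∈ t, ENNReal.ofReal (w i) *
          ‖S (a * l * (a⁻¹ * z i)) - S' (a * l * (a⁻¹ * z i))‖ₑ := by
      rw [← Finset.sum_sub_distrib]
      refine (enorm_sum_le _ _).trans (Finset.sum_le_sum fun i hi => ?_)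
      rw [← smul_sub, enorm_smul, Real.enorm_of_nonneg (hwz i hi).1, enorm_sub_rev,
        mul_assoc (a * l)]
    calc _ = ‖(avg ν F S - avg ν F (fun n => S' (a * l * a⁻¹ * n)))
          + (avg ν F (fun n => S' (a * l * a⁻¹ * n)) - ∑ i ∈ t, w i • S' (a * l * a⁻¹ * z i))
          + (∑ i ∈ t, w i • S' (a * l * a⁻¹ * z i) - ∑ i ∈ t, w i • S (a * l * a⁻¹ * z i))‖ₑ := by
            congr 1; abel
      _ ≤ (δ + η / 2) + η / 2 + _ := (enorm_add_le _ _).trans (add_le_add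
          ((enorm_add_le _ _).trans (add_le_add h1 h2)) h3)
      _ = _ := by rw [add_assoc δ, ENNReal.add_halves]
  have hKm : ∀ᵐ l ∂(ν.restrict I), l ∈ K :=
    ae_mono (restrict_mono_set ν hIK) (ae_restrict_mem hK.measurableSet)
  calc _ ≤ ∫⁻ l in I, ((δ + η) + ∑ i ∈ t, ENNReal.ofReal (w i) *
        ‖S (a * l * (a⁻¹ * z i)) - S' (a * l * (a⁻¹ * z i))‖ₑ) ∂ν :=
        lintegral_mono_ae (hKm.mono hpt)
    _ = (δ + η) * ν I + ∑ i ∈ t, ENNReal.ofReal (w i) *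
        ∫⁻ l in I, ‖S (a * l * (a⁻¹ * z i)) - S' (a * l * (a⁻¹ * z i))‖ₑ ∂ν := by
      rw [lintegral_add_left measurable_const, setLIntegral_const, lintegral_finsetSum']
      · congr 1
        exact Finset.sum_congr rfl fun i _ => lintegral_const_mul' _ _ ENNReal.ofReal_ne_top
      · exact fun i hi => ((hz i hi).1.mono_measure (restrict_mono_set ν hIK)).const_mul _
    _ ≤ (δ + η) * ν I + ∑ i ∈ t, ENNReal.ofReal (w i) * η := by
      gcongr with i hi
      exact (lintegral_mono_set hIK).trans (hz i hi).2
    _ = (δ + η) * ν I + η := by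
      rw [← Finset.sum_mul, ← ENNReal.ofReal_sum_of_nonneg fun i hi => (hwz i hi).1, hw1,
        ENNReal.ofReal_one, one_mul]

end ConvexApproximation

/-! ### Almost orthogonal vectors. -/

section AlmostOrthogonality

variable {𝕜 H : Type*} [RCLike 𝕜] [NormedAddCommGroup H] [InnerProductSpace 𝕜 H]

/-- When the vectors are added in increasing order, each new one contributes its own square, at most
`4`, and twice its inner product with the sum of the earlier ones. -/
lemma norm_sum_sq_le_of_sum_inner_le {s : Finset ℕ} {τ : ℕ → H} (hτ : ∀ k ∈ s, ‖τ k‖ ≤ 2) {B : ℝ}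
    (hB : ∀ k ∈ s, ∑ i ∈ s with i < k, |RCLike.re (inner 𝕜 (τ i) (τ k))| ≤ B) :
    ‖∑ k ∈ s, τ k‖ ^ 2 ≤ s.card * (4 + 2 * B) := by
  induction s using Finset.induction_on_max with
  | empty => simp
  | insert k s hk ih =>
    have hks : k ∉ s := fun h => lt_irrefl _ (hk k h)
    have h1 := ih (fun j hj => hτ j (Finset.mem_insert_of_mem hj)) fun j hj => by
      have := hB j (Finset.mem_insert_of_mem hj)
      rwa [Finset.filter_insert, if_neg (hk j hj).not_gt] at this
    have h2 := hB k (Finset.mem_insert_self _ _)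
    rw [Finset.filter_insert, if_neg (lt_irrefl k), Finset.filter_true_of_mem hk] at h2
    have h3 : RCLike.re (inner 𝕜 (∑ i ∈ s, τ i) (τ k)) ≤ B := by
      rw [sum_inner, map_sum]
      exact (Finset.sum_le_sum fun i _ => le_abs_self _).trans h2
    have h4 : ‖τ k‖ ^ 2 ≤ 4 := by
      nlinarith [hτ k (Finset.mem_insert_self _ _), norm_nonneg (τ k)]
    rw [Finset.sum_insert hks, Finset.card_insert_of_notMem hks, add_comm (τ k),
      norm_add_sq (𝕜 := 𝕜)]
    push_cast
    linarith

/-- Vectors that correlate with a fixed vector and are almost orthogonal to each other are few. -/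
lemma card_le_of_almost_orthogonal {s : Finset ℕ} {τ : ℕ → H} (hτ : ∀ k ∈ s, ‖τ k‖ ≤ 2) {f : H}
    (hf : ‖f‖ ≤ 1) {β A κ : ℝ} (hβ : 0 < β) (hA : 0 ≤ A) (hκ : 4 * κ ≤ β ^ 2)
    (hcor : ∀ k ∈ s, β ≤ RCLike.re (inner 𝕜 (τ k) f))
    (hort : ∀ k ∈ s, ∑ i ∈ s with i < k, |RCLike.re (inner 𝕜 (τ i) (τ k))| ≤ A + κ * s.card) :
    (s.card : ℝ) ≤ (8 + 4 * A) / β ^ 2 := by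
  rcases s.eq_empty_or_nonempty with rfl | hs
  · simpa using by positivity
  have hM : (0 : ℝ) < s.card := by exact_mod_cast hs.card_pos
  have h1 := norm_sum_sq_le_of_sum_inner_le (𝕜 := 𝕜) hτ hort
  have h2 : s.card * β ≤ ‖∑ k ∈ s, τ k‖ := by
    calc s.card * β = ∑ k ∈ s, β := by simp
      _ ≤ ∑ k ∈ s, RCLike.re (inner 𝕜 (τ k) f) := Finset.sum_le_sum hcor
      _ = RCLike.re (inner 𝕜 (∑ k ∈ s, τ k) f) := by rw [sum_inner, map_sum]
      _ ≤ ‖∑ k ∈ s, τ k‖ * ‖f‖ := (RCLike.re_le_norm _).trans (norm_inner_le_norm _ _)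
      _ ≤ ‖∑ k ∈ s, τ k‖ := mul_le_of_le_one_right (norm_nonneg _) hf
  have h3 : (s.card * β) ^ 2 ≤ s.card * (4 + 2 * (A + κ * s.card)) :=
    (pow_le_pow_left₀ (by positivity) h2 2).trans h1
  have h4 : s.card * β ^ 2 ≤ 4 + 2 * (A + κ * s.card) := by
    refine le_of_mul_le_mul_left ?_ hM
    linarith
  rw [le_div_iff₀ (by positivity)]
  nlinarith

end AlmostOrthogonality

/-! ### Rapid sequences and fluctuation bounds. -/

section Fluctuations

variable {𝕜 : Type*} [RCLike 𝕜] {X : Type*} [MeasurableSpace X] {μ : Measure X}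
  [IsProbabilityMeasure μ] {G : Subgroup (UnitaryOp 𝕜 μ)} (hG : ∀ U ∈ G, ActsOnLinfty U)
  {Γ : Type*} [Group Γ] [TopologicalSpace Γ] [MeasurableSpace Γ] (ν : Measure Γ)

/-- `F` is almost invariant under `n ↦ a l a⁻¹ n` for `l ∈ K`. -/
def AlmostInvariant (δ : ℝ) (a : Γ) (K F : Set Γ) : Prop :=
  ∀ l ∈ K, ν (symmDiff ((fun n => a * l * a⁻¹ * n) '' F) F) ≤ ENNReal.ofReal δ * ν F

/-- A finite sequence of pairs of sets `(I i, I' i)`, `i ∈ s`, each of which is almost invariant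
under the preceding sets. -/
structure IsRapid (δ : ℝ) (s : Finset ℕ) (I I' : ℕ → Set Γ) (a a' : ℕ → Γ) : Prop where
  isCompact : ∀ i ∈ s, IsCompact (I i) ∧ IsCompact (I' i)
  ne_zero : ∀ i ∈ s, ν (I i) ≠ 0 ∧ ν (I' i) ≠ 0
  invariant : ∀ i ∈ s, ∀ k ∈ s, i < k →
    AlmostInvariant ν δ (a k) (I i ∪ I' i) (I k) ∧ AlmostInvariant ν δ (a' k) (I i ∪ I' i) (I' k)

variable {ν} in
lemma IsRapid.mono {δ : ℝ} {s t : Finset ℕ} {I I' : ℕ → Set Γ} {a a' : ℕ → Γ}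
    (h : IsRapid ν δ s I I' a a') (hts : t ⊆ s) : IsRapid ν δ t I I' a a' :=
  ⟨fun i hi => h.1 i (hts hi), fun i hi => h.2 i (hts hi),
    fun i hi k hk => h.3 i (hts hi) k (hts hk)⟩

/-- The difference of the averages of `S` over `I` and `I'`. -/
def avgDiff {E : Type*} [NormedAddCommGroup E] [NormedSpace ℝ E] (I I' : Set Γ) (S : Γ → E) : E :=
  avg ν I S - avg ν I' S

/-- Along rapid sequences of pairs of sets, the averages associated with `g` have at most `N`
fluctuations of size at least `ε`. -/
def FluctuationBound (N : ℕ) (ε δ : ℝ) (g : List (Γ → G)) : Prop :=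
  ∀ L : List ((Γ → G) × Linfty 𝕜 μ), (∀ p ∈ L, p.1 ∈ g ∧ p.2 ∈ unitBall 𝕜 μ) →
  ∀ (s : Finset ℕ) (I I' : ℕ → Set Γ) (a a' : ℕ → Γ), IsRapid ν δ s I I' a a' →
    (∀ i ∈ s, ε ≤ ‖avgDiff ν (I i) (I' i) fun n => toL2 (listProd hG L n)‖) → s.card ≤ N

end Fluctuations

/-! ### Elementary properties of averages. -/

section Averages

variable {Γ : Type*} [MeasurableSpace Γ] {ν : Measure Γ} {E : Type*} [NormedAddCommGroup E]
  [NormedSpace ℝ E] {I : Set Γ}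

lemma avg_eq_setAverage (S : Γ → E) : avg ν I S = ⨍ n in I, S n ∂ν :=
  (setAverage_eq _ _ _).symm

lemma norm_avg_le {S : Γ → E} {C : ℝ} (hC : 0 ≤ C) (hS : ∀ n, ‖S n‖ ≤ C) :
    ‖avg ν I S‖ ≤ C := by
  rw [avg, norm_smul, norm_inv, Real.norm_of_nonneg ENNReal.toReal_nonneg]
  by_cases hI : ν I = ∞
  · simpa [hI] using hC
  have h := norm_setIntegral_le_of_norm_le_const (f := S) (s := I) (lt_top_iff_ne_top.2 hI)
    fun n _ => hS n
  rcases eq_or_ne (ν I).toReal 0 with h0 | h0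
  · simpa [h0] using hC
  · rw [inv_mul_le_iff₀ (lt_of_le_of_ne ENNReal.toReal_nonneg h0.symm), mul_comm]
    exact h

lemma map_avg [CompleteSpace E] {F : Type*} [NormedAddCommGroup F] [NormedSpace ℝ F]
    [CompleteSpace F] (T : E →L[ℝ] F) {S : Γ → E} (hS : IntegrableOn S I ν) :
    T (avg ν I S) = avg ν I fun n => T (S n) := by
  rw [avg, avg, map_smul, T.integral_comp_comm hS]

lemma avg_const [CompleteSpace E] (h0 : ν I ≠ 0) (hI : ν I ≠ ∞) (v : E) :
    avg ν I (fun _ => v) = v := by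
  rw [avg_eq_setAverage, setAverage_const h0 hI]

lemma avg_sub {S S' : Γ → E} (hS : IntegrableOn S I ν) (hS' : IntegrableOn S' I ν) :
    avg ν I (fun n => S n - S' n) = avg ν I S - avg ν I S' := by
  rw [avg, avg, avg, integral_sub hS hS', smul_sub]

lemma norm_avgDiff_le_two {S : Γ → E} (I I' : Set Γ) (hS : ∀ n, ‖S n‖ ≤ 1) :
    ‖avgDiff ν I I' S‖ ≤ 2 := by
  have := norm_sub_le (avg ν I S) (avg ν I' S)
  rw [avgDiff]
  linarith [norm_avg_le (ν := ν) (I := I) zero_le_one hS,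
    norm_avg_le (ν := ν) (I := I') zero_le_one hS]

/-- Comparison of an average with a convex combination of averages, given an `L¹` bound. -/
lemma norm_avg_sub_sum_le {ι : Type*} {t : Finset ι} {w : ι → ℝ} {S : Γ → E} {R : ι → Γ → E}
    (hI : ν I ≠ ∞) (h0 : ν I ≠ 0)
    (hS : IntegrableOn S I ν) (hR : ∀ i ∈ t, IntegrableOn (R i) I ν) {κ : ℝ} (hκ : 0 ≤ κ)
    (h : ∫⁻ n in I, ‖S n - ∑ i ∈ t, w i • R i n‖ₑ ∂ν ≤ ENNReal.ofReal κ * ν I) :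
    ‖avg ν I S - ∑ i ∈ t, w i • avg ν I (R i)‖ ≤ κ := by
  have e : avg ν I S - ∑ i ∈ t, w i • avg ν I (R i)
      = avg ν I fun n => S n - ∑ i ∈ t, w i • R i n := by
    have hsum : IntegrableOn (fun n => ∑ i ∈ t, w i • R i n) I ν :=
      integrable_finsetSum t fun i hi => (hR i hi).smul (w i)
    rw [avg_sub hS hsum]
    congr 1
    have hint : ∫ n in I, ∑ i ∈ t, w i • R i n ∂ν = ∑ i ∈ t, ∫ n in I, w i • R i n ∂ν :=
      integral_finsetSum t fun i hi => (hR i hi).smul (w i)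
    simp only [avg]
    rw [hint, Finset.smul_sum]
    refine Finset.sum_congr rfl fun i _ => ?_
    rw [integral_smul, smul_comm]
  have h1 : ‖∫ n in I, (S n - ∑ i ∈ t, w i • R i n) ∂ν‖ₑ ≤ ENNReal.ofReal κ * ν I :=
    (enorm_integral_le_lintegral_enorm _).trans h
  rw [e, ← ENNReal.ofReal_le_ofReal_iff hκ, ofReal_norm, avg, enorm_smul,
    enorm_inv (ENNReal.toReal_ne_zero.2 ⟨h0, hI⟩),
    Real.enorm_of_nonneg ENNReal.toReal_nonneg, ENNReal.ofReal_toReal hI, mul_comm,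
    ← div_eq_mul_inv]
  exact ENNReal.div_le_of_le_mul h1

lemma avg_const_smul (r : ℝ) (S : Γ → E) (I : Set Γ) :
    avg ν I (fun n => r • S n) = r • avg ν I S := by
  rw [avg, avg, integral_smul, smul_comm]

/-- Provides a single additive error that is negligible relative to the measure of every set in the
sequence. -/
lemma exists_pos_le_measure {δ : ℝ} (hδ : 0 < δ) {s : Finset ℕ}
    {I I' : ℕ → Set Γ} (h : ∀ i ∈ s, ν (I i) ≠ 0 ∧ ν (I' i) ≠ 0) :
    ∃ η : ℝ≥0∞, η ≠ 0 ∧ η ≤ ENNReal.ofReal δ ∧ ∀ i ∈ s,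
      η ≤ ENNReal.ofReal δ * ν (I i) ∧ η ≤ ENNReal.ofReal δ * ν (I' i) := by
  have hδ' : ENNReal.ofReal δ ≠ 0 := by simpa using hδ
  refine ⟨min (ENNReal.ofReal δ)
    (s.inf fun i => min (ENNReal.ofReal δ * ν (I i)) (ENNReal.ofReal δ * ν (I' i))), ?_,
    min_le_left _ _, fun i hi => ?_⟩
  · rw [← pos_iff_ne_zero, lt_min_iff, Finset.lt_inf_iff (by simp)]
    refine ⟨pos_iff_ne_zero.2 hδ', fun i hi => ?_⟩
    rw [lt_min_iff, pos_iff_ne_zero, pos_iff_ne_zero]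
    exact ⟨mul_ne_zero hδ' (h i hi).1, mul_ne_zero hδ' (h i hi).2⟩
  · have := (min_le_right (ENNReal.ofReal δ) _).trans
      (Finset.inf_le (f := fun i => min (ENNReal.ofReal δ * ν (I i))
        (ENNReal.ofReal δ * ν (I' i))) hi)
    exact ⟨this.trans (min_le_left _ _), this.trans (min_le_right _ _)⟩

end Averages

section BoundedAverages

variable {𝕜 : Type*} [RCLike 𝕜] {X : Type*} [MeasurableSpace X] {μ : Measure X}
  {Γ : Type*} [MeasurableSpace Γ] {ν : Measure Γ} {I : Set Γ}

lemma avg_mem_ballL2 {S : Γ → Lp 𝕜 2 μ} (hI : ν I ≠ ∞) (h0 : ν I ≠ 0)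
    (hS : IntegrableOn S I ν) (hb : ∀ n, S n ∈ ballL2 𝕜 μ) : avg ν I S ∈ ballL2 𝕜 μ := by
  have h := (convex_ballL2 (𝕜 := 𝕜) (μ := μ)).set_average_mem isClosed_ballL2 h0 hI
    (Eventually.of_forall hb) hS
  rwa [setAverage_eq] at h

lemma re_inner_avg [IsProbabilityMeasure μ] {S : Γ → Lp 𝕜 2 μ} (hS : IntegrableOn S I ν)
    (v : Lp 𝕜 2 μ) : RCLike.re (inner 𝕜 v (avg ν I S))
      = avg ν I fun n => RCLike.re (inner 𝕜 v (S n)) := by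
  let T : Lp 𝕜 2 μ →L[ℝ] ℝ := RCLike.reCLM.comp ((innerSL 𝕜 v).restrictScalars ℝ)
  exact map_avg T hS

lemma re_inner_avgDiff [IsProbabilityMeasure μ] {S : Γ → Lp 𝕜 2 μ} {I' : Set Γ}
    (hS : IntegrableOn S I ν) (hS' : IntegrableOn S I' ν)
    (v : Lp 𝕜 2 μ) : RCLike.re (inner 𝕜 v (avgDiff ν I I' S))
      = avgDiff ν I I' fun n => RCLike.re (inner 𝕜 v (S n)) := by
  rw [avgDiff, inner_sub_right, map_sub, re_inner_avg hS, re_inner_avg hS', avgDiff]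

end BoundedAverages

/-! ### Dual functions and reduced systems. -/

section ReducedSystems

variable {𝕜 : Type*} [RCLike 𝕜] {X : Type*} [MeasurableSpace X] {μ : Measure X}
  [IsProbabilityMeasure μ] {G : Subgroup (UnitaryOp 𝕜 μ)} (hG : ∀ U ∈ G, ActsOnLinfty U)
  {Γ : Type*} [Group Γ]

/-- The list of maps and functions in the reduced system that arises from the pairing of the list
`L`, with entries from `g'`, with the dual function of `e` along `h`. -/
def reducedList (a b : Γ) (h : Γ → G) (e : Linfty 𝕜 μ) (L : List ((Γ → G) × Linfty 𝕜 μ)) :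
    List ((Γ → G) × Linfty 𝕜 μ) :=
  L ++ (bracket a b h (fun _ => 1), e) ::
    L.map fun p => (bracket a b h p.1, conjLinfty p.2)

/-- The integrand `h(n)⁻¹ (e ∏ conj (ψ(n) f))` of the dual function. -/
def dualFun (h : Γ → G) (e : Linfty 𝕜 μ) (L : List ((Γ → G) × Linfty 𝕜 μ)) (n : Γ) :
    Linfty 𝕜 μ :=
  act hG (h n)⁻¹ (e * conjLinfty (listProd hG L n))

/-- The identity behind the definition of the reduction: `h(l) h(alb)⁻¹` is `⟨h|1⟩` on `e`, and
composed with `ψ(alb)` it is `⟨h|ψ⟩` on the conjugate of the function attached to `ψ`. -/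
lemma listProd_reducedList (a b : Γ) (h : Γ → G) (e : Linfty 𝕜 μ)
    (L : List ((Γ → G) × Linfty 𝕜 μ)) (l : Γ) :
    listProd hG (reducedList a b h e L) l
      = listProd hG L l * act hG (h l) (dualFun hG h e L (a * l * b)) := by
  rw [reducedList, listProd_append, listProd_cons, dualFun, ← act_mul, map_mul, conj_listProd,
    act_listProd]
  simp only [listProd, bracket, mul_one, List.map_map, Function.comp_def]

/-- The function `e` is carried by `⟨h|1⟩`, which is why the constant map must belong to `g'`. -/
lemma reducedList_mem {g' : List (Γ → G)} (h1 : (fun _ => 1) ∈ g') (a b : Γ) (h : Γ → G)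
    {e : Linfty 𝕜 μ} (he : e ∈ unitBall 𝕜 μ) {L : List ((Γ → G) × Linfty 𝕜 μ)}
    (hL : ∀ p ∈ L, p.1 ∈ g' ∧ p.2 ∈ unitBall 𝕜 μ) :
    ∀ p ∈ reducedList a b h e L, p.1 ∈ reduction a b g' h ∧ p.2 ∈ unitBall 𝕜 μ := by
  intro p hp
  simp only [reducedList, List.mem_append, List.mem_cons, List.mem_map] at hp
  simp only [reduction, List.mem_append, List.mem_map]
  rcases hp with hp | rfl | ⟨q, hq, rfl⟩
  · exact ⟨Or.inl (hL p hp).1, (hL p hp).2⟩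
  · exact ⟨Or.inr ⟨_, h1, rfl⟩, he⟩
  · exact ⟨Or.inr ⟨_, (hL q hq).1, rfl⟩, conjLinfty_mem_unitBall (hL q hq).2⟩

lemma dualFun_mem_unitBall (h : Γ → G) {e : Linfty 𝕜 μ} (he : e ∈ unitBall 𝕜 μ)
    {L : List ((Γ → G) × Linfty 𝕜 μ)} (hL : ∀ p ∈ L, p.2 ∈ unitBall 𝕜 μ) (n : Γ) :
    dualFun hG h e L n ∈ unitBall 𝕜 μ :=
  act_mem_unitBall hG _
    (mul_mem he (conjLinfty_mem_unitBall (listProd_mem_unitBall hG hL n)))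

/-- The pairing of a function with the integrand of the dual function. -/
lemma inner_dualFun (h : Γ → G) (e f : Linfty 𝕜 μ) (L : List ((Γ → G) × Linfty 𝕜 μ)) (n : Γ) :
    inner 𝕜 (toL2 f) (toL2 (dualFun hG h e L n))
      = inner 𝕜 (toL2 (listProd hG L n * act hG (h n) f)) (toL2 e) := by
  have h1 : toL2 (act hG (h n) (dualFun hG h e L n))
      = toL2 (e * conjLinfty (listProd hG L n)) := by
    rw [dualFun, ← act_mul, mul_inv_cancel, act_one]
  have h2 : conjLinfty (conjLinfty (listProd hG L n)) = listProd hG L n :=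
    Subtype.ext (star_star _)
  rw [← (h n).1.inner_map_map, ← toL2_act hG, ← toL2_act hG, h1, mul_comm e, ← mulOp_toL2,
    inner_mulOp_right, mulOp_toL2, h2]

variable [TopologicalSpace Γ] [MeasurableSpace Γ] {ν : Measure Γ}

lemma aestronglyMeasurable_dualFun {h : Γ → G} (hh : MeasurableMap ν G h) {e : Linfty 𝕜 μ}
    (he : e ∈ unitBall 𝕜 μ) {L : List ((Γ → G) × Linfty 𝕜 μ)}
    (hL : ∀ p ∈ L, MeasurableMap ν G p.1 ∧ p.2 ∈ unitBall 𝕜 μ) {K : Set Γ} (hK : IsCompact K) :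
    AEStronglyMeasurable (fun n => toL2 (dualFun hG h e L n)) (ν.restrict K) := by
  refine hh.aestronglyMeasurable_inv_act hG hK (aestronglyMeasurable_toL2_mul (fun _ => he)
    (fun n => conjLinfty_mem_unitBall (listProd_mem_unitBall hG (fun p hp => (hL p hp).2) n))
    aestronglyMeasurable_const ?_)
  simp only [conj_listProd]
  refine aestronglyMeasurable_listProd hG (fun p hp => ?_) hK
  obtain ⟨q, hq, rfl⟩ := List.mem_map.1 hp
  exact ⟨(hL q hq).1, conjLinfty_mem_unitBall (hL q hq).2⟩

/-- At most `N` differences reach `ε`, and these are at most `2` each; the others are below `ε`. -/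
lemma sum_norm_avgDiff_le {g : List (Γ → G)} {N : ℕ} {ε δ : ℝ} (hε : 0 ≤ ε)
    (hb : FluctuationBound hG ν N ε δ g)
    {L : List ((Γ → G) × Linfty 𝕜 μ)} (hL : ∀ p ∈ L, p.1 ∈ g ∧ p.2 ∈ unitBall 𝕜 μ)
    {s : Finset ℕ} {I I' : ℕ → Set Γ} {a a' : ℕ → Γ} (hs : IsRapid ν δ s I I' a a') :
    ∑ i ∈ s, ‖avgDiff ν (I i) (I' i) fun n => toL2 (listProd hG L n)‖
      ≤ 2 * N + ε * s.card := by
  set D : ℕ → ℝ := fun i => ‖avgDiff ν (I i) (I' i) fun n => toL2 (listProd hG L n)‖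
  have h1 := hb L hL _ I I' a a' (hs.mono (Finset.filter_subset (fun i => ε ≤ D i) s))
    fun i hi => (Finset.mem_filter.1 hi).2
  rw [← Finset.sum_filter_add_sum_filter_not s (fun i => ε ≤ D i)]
  have h2 : ∑ i ∈ s with ε ≤ D i, D i ≤ (s.filter fun i => ε ≤ D i).card • (2 : ℝ) :=
    Finset.sum_le_card_nsmul _ _ _ fun i _ => norm_avgDiff_le_two _ _ fun n =>
      norm_toL2_le_one (listProd_mem_unitBall hG (fun p hp => (hL p hp).2) n)
  have h3 : ∑ i ∈ s with ¬ ε ≤ D i, D i ≤ (s.filter fun i => ¬ ε ≤ D i).card • ε :=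
    Finset.sum_le_card_nsmul _ _ _ fun i hi => (not_le.1 (Finset.mem_filter.1 hi).2).le
  have h4 : ((s.filter fun i => ¬ ε ≤ D i).card : ℝ) ≤ s.card := by
    exact_mod_cast Finset.card_filter_le _ _
  have h5 : ((s.filter fun i => ε ≤ D i).card : ℝ) ≤ N := by exact_mod_cast h1
  rw [nsmul_eq_mul] at h2 h3
  nlinarith

end ReducedSystems

section ReducedBound

variable {𝕜 : Type*} [RCLike 𝕜] {X : Type*} [MeasurableSpace X] {μ : Measure X}
  [IsProbabilityMeasure μ] {G : Subgroup (UnitaryOp 𝕜 μ)} (hG : ∀ U ∈ G, ActsOnLinfty U)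
  {Γ : Type*} [Group Γ] [TopologicalSpace Γ] [IsTopologicalGroup Γ]
  [LocallyCompactSpace Γ] [T2Space Γ] [MeasurableSpace Γ] [BorelSpace Γ] {ν : Measure Γ}
  [ν.IsHaarMeasure]

lemma integrableOn_listProd {g : List (Γ → G)} (hg : IsSystem ν G g)
    {L : List ((Γ → G) × Linfty 𝕜 μ)} (hL : ∀ p ∈ L, p.1 ∈ g ∧ p.2 ∈ unitBall 𝕜 μ) {K : Set Γ}
    (hK : IsCompact K) : IntegrableOn (fun n => toL2 (listProd hG L n)) K ν :=
  integrableOn_of_norm_le_one ν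
    (fun n => norm_toL2_le_one (listProd_mem_unitBall hG (fun p hp => (hL p hp).2) n)) hK
    (aestronglyMeasurable_listProd hG
      (fun p hp => ⟨hg.measurable _ (hL p hp).1, (hL p hp).2⟩) hK)

/-- Multiplication by `P` and application of an isometry is a contraction. -/
lemma enorm_mul_act_sub_sum_le {ι : Type*} {t : Finset ι} {w : ι → ℝ} {P φ : Linfty 𝕜 μ}
    {ψ : ι → Linfty 𝕜 μ} (hP : P ∈ unitBall 𝕜 μ) (k : G) :
    ‖toL2 (P * act hG k φ) - ∑ i ∈ t, w i • toL2 (P * act hG k (ψ i))‖ₑ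
      ≤ ‖toL2 φ - ∑ i ∈ t, w i • toL2 (ψ i)‖ₑ := by
  let T : Lp 𝕜 2 μ →L[𝕜] Lp 𝕜 2 μ := (mulOp P).comp k.1.toContinuousLinearEquiv.toContinuousLinearMap
  have hT : ∀ f, toL2 (P * act hG k f) = T (toL2 f) := fun f => (mulOp_toL2 _ _).symm
  have e : toL2 (P * act hG k φ) - ∑ i ∈ t, w i • toL2 (P * act hG k (ψ i))
      = T (toL2 φ - ∑ i ∈ t, w i • toL2 (ψ i)) := by
    rw [map_sub, map_sum, hT]
    congr 1
    refine Finset.sum_congr rfl fun i _ => ?_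
    rw [hT, map_real_smul T T.continuous]
  rw [e, ← ofReal_norm, ← ofReal_norm]
  exact ENNReal.ofReal_le_ofReal ((norm_mulOp_le hP _).trans (k.1.norm_map _).le)

/-- Averages against a dual function over a large set are controlled by the fluctuations of the
reduced systems. -/
lemma sum_norm_avgDiff_dual_le {g' : List (Γ → G)} {h : Γ → G} (hsys : IsSystem ν G (g' ++ [h]))
    (h1 : (fun _ => 1) ∈ g') {N : ℕ} {ε δ : ℝ} (hε : 0 ≤ ε) (hδ : 0 < δ) (a : Γ)
    (hred : ∀ b, IsSystem ν G (reduction a b g' h) ∧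
      FluctuationBound hG ν N ε δ (reduction a b g' h))
    {L : List ((Γ → G) × Linfty 𝕜 μ)} (hL : ∀ p ∈ L, p.1 ∈ g' ∧ p.2 ∈ unitBall 𝕜 μ)
    {e : Linfty 𝕜 μ} (he : e ∈ unitBall 𝕜 μ) {s : Finset ℕ} {I I' : ℕ → Set Γ} {c c' : ℕ → Γ}
    (hs : IsRapid ν δ s I I' c c') {F : Set Γ} (hF : IsCompact F) (hF0 : ν F ≠ 0)
    (hinv : ∀ i ∈ s, AlmostInvariant ν δ a (I i ∪ I' i) F) {φ : Linfty 𝕜 μ}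
    (hφ : φ ∈ unitBall 𝕜 μ) (hφa : toL2 φ = avg ν F fun n => toL2 (dualFun hG h e L n)) :
    ∑ i ∈ s, ‖avgDiff ν (I i) (I' i) fun l => toL2 (listProd hG L l * act hG (h l) φ)‖
      ≤ 2 * N + (ε + 6 * δ) * s.card := by
  have hLm : ∀ p ∈ L, MeasurableMap ν G p.1 ∧ p.2 ∈ unitBall 𝕜 μ := fun p hp =>
    ⟨hsys.measurable _ (List.mem_append_left _ (hL p hp).1), (hL p hp).2⟩
  have hLb : ∀ p ∈ L, p.2 ∈ unitBall 𝕜 μ := fun p hp => (hL p hp).2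
  obtain ⟨η, hη0, hηδ, hη⟩ := exists_pos_le_measure hδ hs.ne_zero
  -- A single `K` for the whole sequence makes the convex combination independent of `i`. The sums
  -- over `i` and over the combination can then be interchanged, and the fluctuation bound applies
  -- to each reduced product separately.
  let K : Set Γ := ⋃ i ∈ s, (I i ∪ I' i)
  have hK : IsCompact K := s.isCompact_biUnion fun i hi =>
    (hs.isCompact i hi).1.union (hs.isCompact i hi).2
  have hIK : ∀ i ∈ s, I i ∪ I' i ⊆ K := fun i hi => Set.subset_biUnion_of_mem (u := fun i =>
    I i ∪ I' i) (Finset.mem_coe.2 hi)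
  obtain ⟨ι, t, w, z, hwz, hw1, happ⟩ := exists_convexCombination ν
    (S := fun n => toL2 (dualFun hG h e L n)) (K := K)
    (fun n => norm_toL2_le_one (dualFun_mem_unitBall hG h he hLb n))
    (fun W hW => aestronglyMeasurable_dualFun hG
      (hsys.measurable h (List.mem_append_right _ (List.mem_singleton_self h))) he hLm hW)
    hF hF0 hK a (δ := ENNReal.ofReal δ) (fun l hl => by
      obtain ⟨i, hi, hl⟩ := Set.mem_iUnion₂.1 hl
      exact hinv i hi l hl) hη0
  -- With `b = a⁻¹ z`, the point `a l b` is the point `a l a⁻¹ z` of the convex combination.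
  let R : ι → List ((Γ → G) × Linfty 𝕜 μ) := fun i => reducedList a (a⁻¹ * z i) h e L
  have hR : ∀ i, ∀ p ∈ R i, p.1 ∈ reduction a (a⁻¹ * z i) g' h ∧ p.2 ∈ unitBall 𝕜 μ :=
    fun i => reducedList_mem h1 a _ h he hL
  have hint : ∀ J, IsCompact J →
      IntegrableOn (fun l => toL2 (listProd hG L l * act hG (h l) φ)) J ν := by
    intro J hJ
    have := integrableOn_listProd hG hsys (L := L ++ [(h, φ)]) (K := J) (fun p hp => by
      rcases List.mem_append.1 hp with hp | hp
      · exact ⟨List.mem_append_left _ (hL p hp).1, hLb p hp⟩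
      · rw [List.mem_singleton.1 hp]
        exact ⟨List.mem_append_right _ (List.mem_singleton_self h), hφ⟩) hJ
    simpa [listProd_append, listProd] using this
  -- One `δ` comes from almost invariance, and two come from `η`, which enters both relative to `ν
  -- J` and additively. Using this for `I i` and `I' i` yields `6 * δ`.
  have key : ∀ J ⊆ K, IsCompact J → ν J ≠ 0 → η ≤ ENNReal.ofReal δ * ν J →
      ‖avg ν J (fun l => toL2 (listProd hG L l * act hG (h l) φ))
        - ∑ i ∈ t, w i • avg ν J fun l => toL2 (listProd hG (R i) l)‖ ≤ 3 * δ := by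
    intro J hJK hJ hJ0 hJη
    refine norm_avg_sub_sum_le hJ.measure_ne_top hJ0 (hint J hJ)
      (fun i _ => integrableOn_listProd hG (hred _).1 (hR i) hJ) (by positivity) ?_
    calc _ ≤ ∫⁻ l in J, ‖avg ν F (fun n => toL2 (dualFun hG h e L n))
          - ∑ i ∈ t, w i • toL2 (dualFun hG h e L (a * l * a⁻¹ * z i))‖ₑ ∂ν := by
          refine lintegral_mono fun l => ?_
          simp only [R, listProd_reducedList, ← hφa, mul_assoc (a * l)]
          exact enorm_mul_act_sub_sum_le hG (listProd_mem_unitBall hG hLb l) (h l)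
      _ ≤ (ENNReal.ofReal δ + η) * ν J + η := happ J hJK
      _ ≤ (ENNReal.ofReal δ + ENNReal.ofReal δ) * ν J + ENNReal.ofReal δ * ν J := by gcongr
      _ = ENNReal.ofReal (3 * δ) * ν J := by
        rw [ENNReal.ofReal_mul (by norm_num), ENNReal.ofReal_ofNat]
        ring
  have hpt : ∀ i ∈ s, ‖avgDiff ν (I i) (I' i) fun l => toL2 (listProd hG L l * act hG (h l) φ)‖
      ≤ ∑ j ∈ t, w j * ‖avgDiff ν (I i) (I' i) fun l => toL2 (listProd hG (R j) l)‖ + 6 * δ := by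
    intro i hi
    have k1 := key (I i) (Set.subset_union_left.trans (hIK i hi)) (hs.isCompact i hi).1
      (hs.ne_zero i hi).1 (hη i hi).1
    have k2 := key (I' i) (Set.subset_union_right.trans (hIK i hi)) (hs.isCompact i hi).2
      (hs.ne_zero i hi).2 (hη i hi).2
    have k3 : ‖∑ j ∈ t, w j • avgDiff ν (I i) (I' i) fun l => toL2 (listProd hG (R j) l)‖
        ≤ ∑ j ∈ t, w j * ‖avgDiff ν (I i) (I' i) fun l => toL2 (listProd hG (R j) l)‖ := by
      refine (norm_sum_le _ _).trans (Finset.sum_le_sum fun j hj => ?_)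
      rw [norm_smul, Real.norm_of_nonneg (hwz j hj).1]
    simp only [avgDiff, smul_sub, Finset.sum_sub_distrib] at k3 ⊢
    generalize avg ν (I i) (fun l => toL2 (listProd hG L l * act hG (h l) φ)) = x at *
    generalize avg ν (I' i) (fun l => toL2 (listProd hG L l * act hG (h l) φ)) = x' at *
    generalize ∑ j ∈ t, w j • avg ν (I i) (fun l => toL2 (listProd hG (R j) l)) = y at *
    generalize ∑ j ∈ t, w j • avg ν (I' i) (fun l => toL2 (listProd hG (R j) l)) = y' at *
    have e : x - x' = (x - y) - (x' - y') + (y - y') := by abel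
    have n1 := norm_add_le ((x - y) - (x' - y')) (y - y')
    have n2 := norm_sub_le (x - y) (x' - y')
    rw [e]
    linarith
  calc _ ≤ ∑ i ∈ s, (∑ j ∈ t, w j *
        ‖avgDiff ν (I i) (I' i) fun l => toL2 (listProd hG (R j) l)‖ + 6 * δ) :=
        Finset.sum_le_sum hpt
    _ = ∑ j ∈ t, w j * (∑ i ∈ s, ‖avgDiff ν (I i) (I' i) fun l => toL2 (listProd hG (R j) l)‖)
        + 6 * δ * s.card := by
      rw [Finset.sum_add_distrib, Finset.sum_comm]
      simp only [Finset.mul_sum, Finset.sum_const, nsmul_eq_mul]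
      ring
    _ ≤ ∑ j ∈ t, w j * (2 * N + ε * s.card) + 6 * δ * s.card := by
      gcongr with j hj
      · exact (hwz j hj).1
      · exact sum_norm_avgDiff_le hG hε (hred _).2 (hR j) hs
    _ = 2 * N + (ε + 6 * δ) * s.card := by
      rw [← Finset.sum_mul, hw1]
      ring

end ReducedBound

/-! ### Induction on the complexity. -/

section Complexity

variable {𝕜 : Type*} [RCLike 𝕜] {X : Type*} [MeasurableSpace X] {μ : Measure X}
  {G : Subgroup (UnitaryOp 𝕜 μ)} {Γ : Type*} [Group Γ] [TopologicalSpace Γ] [MeasurableSpace Γ]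
  {ν : Measure Γ}

lemma ComplexityLE.isSystem {c : ℕ} {g : List (Γ → G)} (h : ComplexityLE ν G c g) :
    IsSystem ν G g := by
  cases h with
  | trivial =>
    refine ⟨rfl, fun φ hφ K _ f => ?_⟩
    rw [List.mem_singleton.1 hφ]
    exact ⟨aestronglyMeasurable_const, aestronglyMeasurable_const⟩
  | reduce g' h hsys hred => exact hsys
  | cheat g gt hg hsys hcheat => exact hsys

lemma IsRapid.mono_delta {δ δ' : ℝ} (hδ : δ ≤ δ') {s : Finset ℕ} {I I' : ℕ → Set Γ}
    {a a' : ℕ → Γ} (h : IsRapid ν δ s I I' a a') : IsRapid ν δ' s I I' a a' := by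
  have key : ∀ (b : Γ) (K F : Set Γ), AlmostInvariant ν δ b K F → AlmostInvariant ν δ' b K F :=
    fun b K F hF l hl => (hF l hl).trans (by gcongr)
  exact ⟨h.1, h.2, fun i hi k hk hik =>
    ⟨key _ _ _ (h.3 i hi k hk hik).1, key _ _ _ (h.3 i hi k hk hik).2⟩⟩

variable [IsProbabilityMeasure μ] (hG : ∀ U ∈ G, ActsOnLinfty U)

lemma FluctuationBound.mono_delta {N : ℕ} {ε δ δ' : ℝ} (hδ : δ ≤ δ') {g : List (Γ → G)}
    (h : FluctuationBound hG ν N ε δ' g) : FluctuationBound hG ν N ε δ g :=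
  fun L hL s I I' a a' hs => h L hL s I I' a a' (hs.mono_delta hδ)

/-- Since `(ψ(n) k) f = ψ(n) (k f)` and `k` preserves the unit ball, products along `gt` are
products along `g`. This uses that the bound is uniform in the functions. -/
lemma FluctuationBound.cheat {N : ℕ} {ε δ : ℝ} {g gt : List (Γ → G)}
    (h : FluctuationBound hG ν N ε δ g)
    (hgt : ∀ φ ∈ gt, ∃ ψ ∈ g, ∃ k : G, φ = fun n => ψ n * k) :
    FluctuationBound hG ν N ε δ gt := by
  intro L hL
  obtain ⟨L', hL', he⟩ : ∃ L' : List ((Γ → G) × Linfty 𝕜 μ),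
      (∀ p ∈ L', p.1 ∈ g ∧ p.2 ∈ unitBall 𝕜 μ) ∧ listProd hG L = listProd hG L' := by
    induction L with
    | nil => exact ⟨[], by simp, rfl⟩
    | cons p L ih =>
      obtain ⟨L', hL', he⟩ := ih fun q hq => hL q (List.mem_cons_of_mem _ hq)
      obtain ⟨hp1, hp2⟩ := hL p List.mem_cons_self
      obtain ⟨ψ, hψ, k, hk⟩ := hgt p.1 hp1
      refine ⟨(ψ, act hG k p.2) :: L', ?_, ?_⟩
      · intro q hq
        rcases List.mem_cons.1 hq with rfl | hq
        exacts [⟨hψ, act_mem_unitBall hG k hp2⟩, hL' q hq]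
      · funext n
        rw [listProd_cons, listProd_cons, he, hk, act_mul]
  rw [he]
  exact h L' hL'

end Complexity

section Induction

variable {𝕜 : Type*} [RCLike 𝕜] {X : Type*} [MeasurableSpace X] {μ : Measure X}
  [IsProbabilityMeasure μ] {G : Subgroup (UnitaryOp 𝕜 μ)} (hG : ∀ U ∈ G, ActsOnLinfty U)
  {Γ : Type*} [Group Γ] [TopologicalSpace Γ] [IsTopologicalGroup Γ]
  [LocallyCompactSpace Γ] [T2Space Γ] [MeasurableSpace Γ] [BorelSpace Γ] {ν : Measure Γ}
  [ν.IsHaarMeasure]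

/-- A system inherits a fluctuation bound from its reductions. -/
lemma fluctuationBound_of_reduction {g' : List (Γ → G)} {h : Γ → G}
    (hsys : IsSystem ν G (g' ++ [h])) (h1 : (fun _ => 1) ∈ g') {N : ℕ} {ε δ : ℝ} (hε : 0 < ε)
    (hδ : 0 < δ) (hδε : δ ≤ ε ^ 4 / 400)
    (hred : ∀ a b, IsSystem ν G (reduction a b g' h) ∧
      FluctuationBound hG ν N (ε ^ 4 / 64) δ (reduction a b g' h)) :
    FluctuationBound hG ν ⌈(8 + 4 * (4 * N)) / (ε ^ 2 / 2) ^ 2⌉₊ ε δ (g' ++ [h]) := by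
  intro L₀ hL₀ s I I' a a' hs hD
  obtain ⟨L, f, hL, hf, hLf⟩ := exists_listProd_eq_mul hG g' h L₀ hL₀
  have hLb : ∀ p ∈ L, p.2 ∈ unitBall 𝕜 μ := fun p hp => (hL p hp).2
  have hLm : ∀ p ∈ L, MeasurableMap ν G p.1 ∧ p.2 ∈ unitBall 𝕜 μ := fun p hp =>
    ⟨hsys.measurable _ (List.mem_append_left _ (hL p hp).1), (hL p hp).2⟩
  have hhm : MeasurableMap ν G h :=
    hsys.measurable h (List.mem_append_right _ (List.mem_singleton_self h))
  let A : ℕ → Linfty 𝕜 μ → Lp 𝕜 2 μ := fun i φ =>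
    avgDiff ν (I i) (I' i) fun n => toL2 (listProd hG L n * act hG (h n) φ)
  have hA : ∀ i ∈ s, ε ≤ ‖A i f‖ := by simpa only [A, ← hLf] using hD
  have hint : ∀ J, IsCompact J → ∀ φ ∈ unitBall 𝕜 μ,
      IntegrableOn (fun n => toL2 (listProd hG L n * act hG (h n) φ)) J ν := fun J hJ φ hφ => by
    refine integrableOn_of_norm_le_one ν (fun n => norm_toL2_le_one
      (mul_mem (listProd_mem_unitBall hG hLb n) (act_mem_unitBall hG _ hφ))) hJ ?_
    exact aestronglyMeasurable_toL2_mul (fun n => listProd_mem_unitBall hG hLb n)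
      (fun n => act_mem_unitBall hG _ hφ) (aestronglyMeasurable_listProd hG hLm hJ)
      (hhm.aestronglyMeasurable_act hG hJ aestronglyMeasurable_const)
  have hmem : ∀ J, IsCompact J → ν J ≠ 0 → ∀ S : Γ → Linfty 𝕜 μ, (∀ n, S n ∈ unitBall 𝕜 μ) →
      IntegrableOn (fun n => toL2 (S n)) J ν → avg ν J (fun n => toL2 (S n)) ∈ ballL2 𝕜 μ :=
    fun J hJ hJ0 S hS hSi =>
      avg_mem_ballL2 hJ.measure_ne_top hJ0 hSi fun n => toL2_mem_ballL2 (hS n)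
  -- Here `e = A i f / 2`, with a dummy value for indices outside `s`.
  have he : ∀ i, ∃ e ∈ unitBall 𝕜 μ, i ∈ s → A i f = toL2 e + toL2 e := fun i => by
    by_cases hi : i ∈ s
    · have hm := fun n => mul_mem (listProd_mem_unitBall hG hLb n) (act_mem_unitBall hG (h n) hf)
      obtain ⟨e, he, hee⟩ := exists_toL2_eq (half_sub_mem_ballL2
        (hmem _ (hs.isCompact i hi).1 (hs.ne_zero i hi).1 _ hm (hint _ (hs.isCompact i hi).1 f hf))
        (hmem _ (hs.isCompact i hi).2 (hs.ne_zero i hi).2 _ hm (hint _ (hs.isCompact i hi).2 f hf)))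
      refine ⟨e, he, fun _ => ?_⟩
      rw [hee, ← add_smul]
      norm_num [A, avgDiff]
    · exact ⟨1, one_mem _, fun hi' => absurd hi' hi⟩
  choose e he heA using he
  have hSb : ∀ i n, dualFun hG h (e i) L n ∈ unitBall 𝕜 μ := fun i n =>
    dualFun_mem_unitBall hG h (he i) hLb n
  have hSi : ∀ i J, IsCompact J → IntegrableOn (fun n => toL2 (dualFun hG h (e i) L n)) J ν :=
    fun i J hJ => integrableOn_of_norm_le_one ν (fun n => norm_toL2_le_one (hSb i n)) hJ
      (aestronglyMeasurable_dualFun hG hhm (he i) hLm hJ)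
  let τ : ℕ → Lp 𝕜 2 μ := fun i =>
    avgDiff ν (I i) (I' i) fun n => toL2 (dualFun hG h (e i) L n)
  -- Duality trades a correlation of `τ i` with `φ` for the size of `A i φ`, to which the reduced
  -- systems apply when `φ` is an average of a dual function.
  have hpair : ∀ i ∈ s, ∀ φ ∈ unitBall 𝕜 μ, RCLike.re (inner 𝕜 (τ i) (toL2 φ))
      = RCLike.re (inner 𝕜 (toL2 (e i)) (A i φ)) := by
    intro i hi φ hφ
    have hc := hs.isCompact i hi
    rw [inner_re_symm, re_inner_avgDiff (hSi i _ hc.1) (hSi i _ hc.2),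
      re_inner_avgDiff (hint _ hc.1 φ hφ) (hint _ hc.2 φ hφ)]
    congr 1
    funext n
    rw [inner_dualFun, inner_re_symm]
  -- Each of the two averages that make up `τ k` contributes `2N` to `A` and `ε⁴/64 + 6δ` to `κ`.
  -- The bound `δ ≤ ε⁴/400` ensures `4κ ≤ β² = ε⁴/4`.
  have hcard := card_le_of_almost_orthogonal (𝕜 := 𝕜) (s := s) (τ := τ) (f := toL2 f)
    (β := ε ^ 2 / 2) (A := 4 * N) (κ := 2 * (ε ^ 4 / 64) + 12 * δ)
    (fun k _ => norm_avgDiff_le_two _ _ fun n => norm_toL2_le_one (hSb k n))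
    (norm_toL2_le_one hf) (by positivity) (by positivity) (by nlinarith) ?_ ?_
  · exact_mod_cast hcard.trans (Nat.le_ceil _)
  · intro k hk
    have h2 := hA k hk
    -- As `A k f` is twice `e k`, the correlation is `2‖e k‖² = ‖A k f‖² / 2 ≥ ε² / 2`.
    rw [hpair k hk f hf, heA k hk, inner_add_right, map_add, inner_self_eq_norm_sq]
    rw [heA k hk, ← two_smul ℝ, norm_smul, Real.norm_ofNat] at h2
    nlinarith
  · intro k hk
    have hc := hs.isCompact k hk
    have h0 := hs.ne_zero k hk
    obtain ⟨φ, hφ, hφa⟩ := exists_toL2_eq (hmem _ hc.1 h0.1 _ (hSb k) (hSi k _ hc.1))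
    obtain ⟨φ', hφ', hφa'⟩ := exists_toL2_eq (hmem _ hc.2 h0.2 _ (hSb k) (hSi k _ hc.2))
    have hτ : τ k = toL2 φ - toL2 φ' := by rw [hφa, hφa']; rfl
    have hsub := Finset.filter_subset (fun i => i < k) s
    have b1 := sum_norm_avgDiff_dual_le hG hsys h1 (by positivity) hδ (a k) (hred (a k)) hL (he k)
      (hs.mono hsub) hc.1 h0.1 (fun i hi => (hs.invariant i (hsub hi) k hk
        (Finset.mem_filter.1 hi).2).1) hφ hφa
    have b2 := sum_norm_avgDiff_dual_le hG hsys h1 (by positivity) hδ (a' k) (hred (a' k)) hL (he k)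
      (hs.mono hsub) hc.2 h0.2 (fun i hi => (hs.invariant i (hsub hi) k hk
        (Finset.mem_filter.1 hi).2).2) hφ' hφa'
    have hin : ∀ i (v : Lp 𝕜 2 μ), |RCLike.re (inner 𝕜 (toL2 (e i)) v)| ≤ ‖v‖ := fun i v =>
      (RCLike.abs_re_le_norm _).trans ((norm_inner_le_norm _ _).trans
        (mul_le_of_le_one_left (norm_nonneg _) (norm_toL2_le_one (he i))))
    have b3 : ∑ i ∈ s with i < k, |RCLike.re (inner 𝕜 (τ i) (τ k))|
        ≤ ∑ i ∈ s with i < k, (‖A i φ‖ + ‖A i φ'‖) := by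
      refine Finset.sum_le_sum fun i hi => ?_
      rw [hτ, inner_sub_right, map_sub, hpair i (hsub hi) φ hφ, hpair i (hsub hi) φ' hφ']
      exact (abs_sub _ _).trans (add_le_add (hin i _) (hin i _))
    have b4 : ((s.filter fun i => i < k).card : ℝ) ≤ s.card := by
      exact_mod_cast Finset.card_le_card hsub
    rw [Finset.sum_add_distrib] at b3
    have b5 : (ε ^ 4 / 64 + 6 * δ) * ((s.filter fun i => i < k).card : ℝ)
        ≤ (ε ^ 4 / 64 + 6 * δ) * s.card := by gcongr
    refine b3.trans ((add_le_add b1 b2).trans ?_)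
    linarith

/-- Systems of complexity at most `c` satisfy uniform fluctuation bounds. -/
theorem exists_fluctuationBound (c : ℕ) : ∀ ε : ℝ, 0 < ε → ∃ (N : ℕ) (δ : ℝ), 0 < δ ∧
    ∀ g : List (Γ → G), ComplexityLE ν G c g → FluctuationBound hG ν N ε δ g := by
  induction c with
  | zero =>
    refine fun ε hε => ⟨0, 1, one_pos, fun g hg => ?_⟩
    generalize hc : 0 = c at hg
    induction hg with
    | trivial =>
      intro L hL s I I' a a' hs hD
      rw [Nat.le_zero, Finset.card_eq_zero, Finset.eq_empty_iff_forall_notMem]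
      intro i hi
      -- Along the trivial system the product is constant, so all averages coincide and there are no
      -- fluctuations.
      have hLc : ∀ n, listProd hG L n = listProd hG L 1 := fun n => by
        unfold listProd
        congr 1
        refine List.map_congr_left fun p hp => ?_
        rw [List.mem_singleton.1 (hL p hp).1]
      have h0 : avgDiff ν (I i) (I' i) (fun n => toL2 (listProd hG L n)) = 0 := by
        simp only [hLc]
        rw [avgDiff, avg_const (hs.ne_zero i hi).1 (hs.isCompact i hi).1.measure_ne_top,
          avg_const (hs.ne_zero i hi).2 (hs.isCompact i hi).2.measure_ne_top, sub_self]
      have := hD i hi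
      rw [h0, norm_zero] at this
      linarith
    | reduce g' h hsys hred ih => omega
    | cheat g gt hg hsys hcheat ih => exact (ih hc).cheat hG hcheat
  | succ c ihc =>
    intro ε hε
    obtain ⟨N, δ, hδ, hN⟩ := ihc (ε ^ 4 / 64) (by positivity)
    refine ⟨⌈(8 + 4 * (4 * N)) / (ε ^ 2 / 2) ^ 2⌉₊, min δ (ε ^ 4 / 400),
      lt_min hδ (by positivity), fun g hg => ?_⟩
    generalize hc : c + 1 = c' at hg
    induction hg with
    | trivial => omega
    | @reduce c'' g' h hsys hred ih =>
      obtain rfl : c = c'' := by omega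
      have h1 : (fun _ => 1) ∈ g' := by
        cases g' with
        -- If `g'` were empty, its reduction would be the empty list, which is not a system.
        | nil => simpa [reduction] using (hred 1 1).isSystem.head_eq
        | cons φ g' =>
          have := hsys.head_eq
          simp only [List.cons_append, List.head?_cons, Option.some.injEq] at this
          rw [this]
          exact List.mem_cons_self
      exact fluctuationBound_of_reduction hG hsys h1 hε (lt_min hδ (by positivity))
        (min_le_right _ _) fun a b => ⟨(hred a b).isSystem,
          (hN _ (hred a b)).mono_delta hG (min_le_left _ _)⟩
    | cheat g gt hg hsys hcheat ih => exact (ih hc).cheat hG hcheat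

end Induction

/-! ### Følner sets and the Cauchy property. -/

section Convergence

open Measure

variable {Γ : Type*} [Group Γ] [TopologicalSpace Γ] [IsTopologicalGroup Γ]
  [LocallyCompactSpace Γ] [T2Space Γ] [MeasurableSpace Γ] [BorelSpace Γ] (ν : Measure Γ)
  [ν.IsHaarMeasure]

lemma measure_twoSidedTranslate (a b : Γ) {s : Set Γ} (hs : MeasurableSet s)
    (hs' : IsCompact (closure s)) :
    ν (twoSidedTranslate a s b) = modularCharacterFun b⁻¹ • ν s := by
  have h : twoSidedTranslate a s b = (fun x => a⁻¹ * x * b⁻¹) ⁻¹' s := by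
    refine Set.Subset.antisymm ?_ fun x hx => ⟨_, hx, ?_⟩
    · rintro _ ⟨x, hx, rfl⟩
      simpa [mul_assoc] using hx
    · simp [mul_assoc]
  rw [h, ← map_apply (by fun_prop) hs, map_mul_mul_apply ν a⁻¹ b⁻¹ hs']

/-- Compact sets of positive measure that are almost invariant under translation by `K`. -/
structure IsFolnerSet (K : Set Γ) (δ : ℝ) (F : Set Γ) : Prop where
  isCompact : IsCompact F
  ne_zero : ν F ≠ 0
  invariant : ∀ l ∈ K, ν (symmDiff ((fun n => l * n) '' F) F) ≤ ENNReal.ofReal δ * ν F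

variable {ν}

lemma isCompact_twoSidedTranslate {F : Set Γ} (hF : IsCompact F) (a b : Γ) :
    IsCompact (twoSidedTranslate a F b) := hF.image (by fun_prop)

lemma IsFolnerSet.twoSidedTranslate_ne_zero {K F : Set Γ} {δ : ℝ} (hF : IsFolnerSet ν K δ F)
    (a b : Γ) : ν (twoSidedTranslate a F b) ≠ 0 := by
  rw [measure_twoSidedTranslate ν a b hF.isCompact.measurableSet hF.isCompact.closure]
  exact smul_ne_zero (modularCharacterFun_pos _).ne' hF.ne_zero

/-- Translating `aFb` by `a l a⁻¹` gives `a(lF)b`. The two-sided translation scales all measures by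
the same modular factor, so the Følner ratio is unchanged. -/
lemma IsFolnerSet.almostInvariant {K F : Set Γ} {δ : ℝ} (hF : IsFolnerSet ν K δ F) (a b : Γ) :
    AlmostInvariant ν δ a K (twoSidedTranslate a F b) := by
  intro l hl
  have hD : IsCompact ((fun n => l * n) '' F) := hF.isCompact.image (by fun_prop)
  have hinj : Function.Injective fun n : Γ => a * n * b := fun x y h => by simpa using h
  have e : symmDiff ((fun n => a * l * a⁻¹ * n) '' twoSidedTranslate a F b)
      (twoSidedTranslate a F b)
      = twoSidedTranslate a (symmDiff ((fun n => l * n) '' F) F) b := by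
    rw [twoSidedTranslate, twoSidedTranslate, Set.image_symmDiff hinj, Set.image_image,
      Set.image_image]
    simp only [mul_assoc, inv_mul_cancel_left]
  rw [e, measure_twoSidedTranslate ν a b (hD.measurableSet.symmDiff hF.isCompact.measurableSet)
    ((hD.union hF.isCompact).closure_of_subset Set.symmDiff_subset_union),
    measure_twoSidedTranslate ν a b hF.isCompact.measurableSet hF.isCompact.closure]
  simp only [ENNReal.smul_def, smul_eq_mul]
  rw [mul_left_comm]
  gcongr
  exact hF.invariant l hl

lemma IsFolnerNet.eventually_isFolnerSet {A : Type*} [Preorder A] {F : A → Set Γ}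
    (hF : IsFolnerNet ν F) {K : Set Γ} (hK : IsCompact K) {δ : ℝ} (hδ : 0 < δ) :
    ∀ᶠ α in atTop, IsFolnerSet ν K δ (F α) := by
  filter_upwards [(tendsto_order.1 (hF.tendsto K hK)).2 _ (ENNReal.ofReal_pos.2 hδ)] with α hα
  refine ⟨hF.isCompact α, (hF.measure_pos α).ne', fun l hl => ?_⟩
  rw [← ENNReal.div_le_iff (hF.measure_pos α).ne' (hF.isCompact α).measure_ne_top]
  exact (le_iSup₂ (f := fun l _ => ν (symmDiff ((fun n => l * n) '' F α) (F α)) / ν (F α))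
    l hl).trans hα.le

variable {E : Type*} [NormedAddCommGroup E] [NormedSpace ℝ E]

variable (ν) in
/-- The averages of `S` over two-sided translates of sufficiently invariant sets are close to each
other. -/
def IsCauchyAverage (S : Γ → E) : Prop :=
  ∀ ε : ℝ, 0 < ε → ∃ (K : Set Γ) (δ : ℝ), IsCompact K ∧ 0 < δ ∧
    ∀ F F' : Set Γ, IsFolnerSet ν K δ F → IsFolnerSet ν K δ F' → ∀ a b a' b' : Γ,
      ‖avg ν (twoSidedTranslate a F b) S - avg ν (twoSidedTranslate a' F' b') S‖ < ε

lemma IsCauchyAverage.const_smul {S : Γ → E} (hS : IsCauchyAverage ν S) (r : ℝ) :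
    IsCauchyAverage ν fun n => r • S n := by
  intro ε hε
  obtain ⟨K, δ, hK, hδ, h⟩ := hS (ε / (|r| + 1)) (by positivity)
  refine ⟨K, δ, hK, hδ, fun F F' hF hF' a b a' b' => ?_⟩
  rw [avg_const_smul, avg_const_smul, ← smul_sub, norm_smul, Real.norm_eq_abs]
  have h1 := h F F' hF hF' a b a' b'
  rw [lt_div_iff₀ (by positivity)] at h1
  nlinarith [norm_nonneg (avg ν (twoSidedTranslate a F b) S
    - avg ν (twoSidedTranslate a' F' b') S)]

/-- The averages of `S` converge along Følner nets, to a common limit. -/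
lemma IsCauchyAverage.exists_tendstoUniformly [CompleteSpace E] {S : Γ → E}
    (hS : IsCauchyAverage ν S) :
    ∃ L : E, ∀ (A : Type*) [Preorder A] [IsDirectedOrder A] [Nonempty A] (F : A → Set Γ),
      IsFolnerNet ν F → TendstoUniformly
        (fun (α : A) (p : Γ × Γ) => avg ν (twoSidedTranslate p.1 (F α) p.2) S)
        (fun _ => L) atTop := by
  -- The limit is taken along one Følner net, to whose tail every other net is compared. Without any
  -- net the claim is vacuous.
  by_cases hex : ∃ (A : Type _) (_ : Preorder A) (_ : IsDirectedOrder A) (_ : Nonempty A)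
    (F : A → Set Γ), IsFolnerNet ν F
  swap
  · exact ⟨0, fun A _ _ _ F hF => absurd ⟨A, _, ‹_›, ‹_›, F, hF⟩ hex⟩
  obtain ⟨A₀, _, _, _, F₀, hF₀⟩ := hex
  let u : A₀ → E := fun α => avg ν (twoSidedTranslate 1 (F₀ α) 1) S
  have hu : Cauchy (map u atTop) := by
    refine Metric.cauchy_iff.2 ⟨inferInstance, fun ε hε => ?_⟩
    obtain ⟨K, δ, hK, hδ, h⟩ := hS ε hε
    refine ⟨_, image_mem_map (hF₀.eventually_isFolnerSet hK hδ), ?_⟩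
    rintro _ ⟨α, hα, rfl⟩ _ ⟨β, hβ, rfl⟩
    rw [dist_eq_norm]
    exact h _ _ hα hβ _ _ _ _
  obtain ⟨L, hL⟩ := CompleteSpace.complete hu
  refine ⟨L, fun A _ _ _ F hF => Metric.tendstoUniformly_iff.2 fun ε hε => ?_⟩
  obtain ⟨K, δ, hK, hδ, h⟩ := hS (ε / 2) (half_pos hε)
  filter_upwards [hF.eventually_isFolnerSet hK hδ] with α hα p
  have hlim : Tendsto u atTop (𝓝 L) := hL
  have hle : ‖L - avg ν (twoSidedTranslate p.1 (F α) p.2) S‖ ≤ ε / 2 :=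
    le_of_tendsto (hlim.sub_const _).norm ((hF₀.eventually_isFolnerSet hK hδ).mono fun β hβ =>
      (h _ _ hβ hα _ _ _ _).le)
  rw [dist_eq_norm]
  linarith

end Convergence

/-! ### Normalization of the functions and convergence. -/

section Main

variable {𝕜 : Type*} [RCLike 𝕜] {X : Type*} [MeasurableSpace X] {μ : Measure X}
  [IsProbabilityMeasure μ]

lemma exists_toL2_eq_smul (f : Linfty 𝕜 μ) :
    ∃ (r : ℝ) (f' : Linfty 𝕜 μ), f' ∈ unitBall 𝕜 μ ∧ toL2 f = r • toL2 f' := by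
  let r : ℝ := (eLpNorm (f.1 : X → 𝕜) ∞ μ).toReal + 1
  have hr : 0 < r := by positivity
  have hmem : MemLp (r⁻¹ • f.1 : X →ₘ[μ] 𝕜) ∞ μ :=
    (memLp_congr_ae (AEEqFun.coeFn_smul r⁻¹ f.1)).2 (f.2.const_smul r⁻¹)
  refine ⟨r, ⟨r⁻¹ • f.1, hmem⟩, mem_unitBall_iff.2 ?_, ?_⟩
  · have hb : ∀ᵐ x ∂μ, ‖f.1 x‖ₑ ≤ eLpNorm (f.1 : X → 𝕜) ∞ μ := by
      rw [eLpNorm_exponent_top]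
      exact ae_le_eLpNormEssSup
    filter_upwards [hb, AEEqFun.coeFn_smul r⁻¹ f.1] with x h1 h2
    rw [h2, Pi.smul_apply, norm_smul, norm_inv, Real.norm_of_nonneg hr.le, inv_mul_le_iff₀ hr]
    have := ENNReal.toReal_mono f.2.2.ne h1
    rw [toReal_enorm] at this
    linarith
  · refine Subtype.ext ?_
    show f.1 = r • (r⁻¹ • f.1)
    rw [smul_inv_smul₀ hr.ne']

lemma toL2_prod_eq_smul {ι : Type*} (s : Finset ι) {x y : ι → Linfty 𝕜 μ} {r : ι → ℝ}
    (h : ∀ i, toL2 (x i) = r i • toL2 (y i)) :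
    toL2 (∏ i ∈ s, x i) = (∏ i ∈ s, r i) • toL2 (∏ i ∈ s, y i) := by
  classical
  induction s using Finset.induction_on with
  | empty => simp
  | insert i s hi ih =>
    rw [Finset.prod_insert hi, Finset.prod_insert hi, Finset.prod_insert hi, ← mulOp_toL2, ih,
      map_real_smul _ (mulOp (x i)).continuous, mulOp_toL2, mul_comm (x i), ← mulOp_toL2, h,
      map_real_smul _ (mulOp _).continuous, mulOp_toL2, smul_smul, mul_comm (r i),
      mul_comm (y i)]

variable {G : Subgroup (UnitaryOp 𝕜 μ)} (hG : ∀ U ∈ G, ActsOnLinfty U) {Γ : Type*} [Group Γ]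

/-- The product along a system is a multiple of a product of functions from the unit ball. -/
lemma exists_productMap_eq_smul (g : List (Γ → G)) (f : Fin g.length → Linfty 𝕜 μ) :
    ∃ (r : ℝ) (L : List ((Γ → G) × Linfty 𝕜 μ)), (∀ p ∈ L, p.1 ∈ g ∧ p.2 ∈ unitBall 𝕜 μ) ∧
      productMap hG g f = fun n => r • toL2 (listProd hG L n) := by
  choose r f' hf' hr using fun i => exists_toL2_eq_smul (f i)
  refine ⟨∏ i, r i, List.ofFn fun i => (g.get i, f' i), fun p hp => ?_, ?_⟩
  · obtain ⟨i, rfl⟩ := (List.mem_ofFn' _ _).1 hp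
    exact ⟨List.get_mem _ _, hf' i⟩
  · funext n
    rw [listProd, List.map_ofFn, List.prod_ofFn]
    refine toL2_prod_eq_smul _ fun i => ?_
    show (g.get i n).1 (toL2 (f i)) = r i • (g.get i n).1 (toL2 (f' i))
    rw [hr, map_real_smul _ (g.get i n).1.continuous]

variable [TopologicalSpace Γ] [IsTopologicalGroup Γ]
  [LocallyCompactSpace Γ] [T2Space Γ] [MeasurableSpace Γ] [BorelSpace Γ] {ν : Measure Γ}
  [ν.IsHaarMeasure]

/-- A fluctuation bound implies that the averages are Cauchy. -/
lemma isCauchyAverage_of_fluctuationBound {g : List (Γ → G)}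
    (hg : ∀ ε : ℝ, 0 < ε → ∃ (N : ℕ) (δ : ℝ), 0 < δ ∧ FluctuationBound hG ν N ε δ g)
    {L : List ((Γ → G) × Linfty 𝕜 μ)} (hL : ∀ p ∈ L, p.1 ∈ g ∧ p.2 ∈ unitBall 𝕜 μ) :
    IsCauchyAverage ν fun n => toL2 (listProd hG L n) := by
  intro ε hε
  obtain ⟨N, δ, hδ, hN⟩ := hg ε hε
  -- With `δ` fixed, failure of the Cauchy property gives a bad pair for every compact `K`.
  by_contra! hbad
  choose F F' hF hF' a b a' b' hbad using
    fun K : {K : Set Γ // IsCompact K} => hbad K.1 δ K.2 hδ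
  let J : {K : Set Γ // IsCompact K} → Set Γ := fun K => twoSidedTranslate (a K) (F K) (b K)
  let J' : {K : Set Γ // IsCompact K} → Set Γ := fun K => twoSidedTranslate (a' K) (F' K) (b' K)
  have hJ : ∀ K, IsCompact (J K) := fun K => isCompact_twoSidedTranslate (hF K).isCompact _ _
  have hJ' : ∀ K, IsCompact (J' K) := fun K => isCompact_twoSidedTranslate (hF' K).isCompact _ _
  -- Each compact set absorbs the pair chosen for the previous one, so each later pair is almost
  -- invariant under all earlier pairs.
  let Ks : ℕ → {K : Set Γ // IsCompact K} := Nat.rec ⟨∅, isCompact_empty⟩ fun _ K =>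
    ⟨K.1 ∪ (J K ∪ J' K), K.2.union ((hJ K).union (hJ' K))⟩
  have hmono : Monotone fun n => (Ks n).1 :=
    monotone_nat_of_le_succ fun n => Set.subset_union_left
  have hsub : ∀ i k, i < k → J (Ks i) ∪ J' (Ks i) ⊆ (Ks k).1 := fun i k hik =>
    Set.subset_union_right.trans (hmono (Nat.succ_le_of_lt hik))
  have hrapid : IsRapid ν δ (Finset.range (N + 1)) (fun i => J (Ks i)) (fun i => J' (Ks i))
      (fun i => a (Ks i)) (fun i => a' (Ks i)) := by
    refine ⟨fun i _ => ⟨hJ _, hJ' _⟩, fun i _ => ⟨(hF _).twoSidedTranslate_ne_zero _ _,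
      (hF' _).twoSidedTranslate_ne_zero _ _⟩, fun i _ k _ hik => ⟨fun l hl => ?_, fun l hl => ?_⟩⟩
    · exact (hF (Ks k)).almostInvariant _ _ l (hsub i k hik hl)
    · exact (hF' (Ks k)).almostInvariant _ _ l (hsub i k hik hl)
  have := hN L hL _ _ _ _ _ hrapid fun i _ => hbad (Ks i)
  rw [Finset.card_range] at this
  omega

end Main

end NilErgodic

end

theorem mainTheorem4
    {𝕜 : Type*} [RCLike 𝕜]
    {X : Type*} [MeasurableSpace X] (μ : Measure X) [IsProbabilityMeasure μ]
    {Γ : Type*} [Group Γ] [TopologicalSpace Γ] [IsTopologicalGroup Γ] [LocallyCompactSpace Γ]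
    [T2Space Γ] [MeasurableSpace Γ] [BorelSpace Γ] (ν : Measure Γ) [ν.IsHaarMeasure]
    (G : Subgroup (NilErgodic.UnitaryOp 𝕜 μ)) (hG : ∀ U ∈ G, NilErgodic.ActsOnLinfty U)
    (g : List (Γ → G)) (hg : NilErgodic.IsSystem ν G g)
    (hc : NilErgodic.FiniteComplexity ν G g)
    (f : Fin g.length → NilErgodic.Linfty 𝕜 μ) :
    -- the averages are well defined
    (∀ K : Set Γ, IsCompact K → IntegrableOn (NilErgodic.productMap hG g f) K ν) ∧
    -- a single limit for all Følner nets, uniformly over the two-sided translates `a F_α b`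
    ∃ L : Lp 𝕜 2 μ, ∀ (A : Type*) [Preorder A] [IsDirectedOrder A] [Nonempty A] (F : A → Set Γ),
      NilErgodic.IsFolnerNet ν F →
      TendstoUniformly
        (fun (α : A) (p : Γ × Γ) =>
          NilErgodic.ergodicAverage ν hG g f (NilErgodic.twoSidedTranslate p.1 (F α) p.2))
        (fun _ => L) atTop := by
  obtain ⟨r, L, hL, hrL⟩ := NilErgodic.exists_productMap_eq_smul hG g f
  obtain ⟨c, hc⟩ := hc
  rw [hrL]
  refine ⟨fun K hK => (NilErgodic.integrableOn_listProd hG hg hL hK).smul r, ?_⟩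
  have hcauchy : NilErgodic.IsCauchyAverage ν
      fun n => r • NilErgodic.toL2 (NilErgodic.listProd hG L n) :=
    (NilErgodic.isCauchyAverage_of_fluctuationBound hG (fun ε hε => by
      obtain ⟨N, δ, hδ, h⟩ := NilErgodic.exists_fluctuationBound (ν := ν) hG c ε hε
      exact ⟨N, δ, hδ, h g hc⟩) hL).const_smul r
  rw [← hrL] at hcauchy
  exact hcauchy.exists_tendstoUniformly
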